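/- Let $(\mathcal C,\otimes,I,\sigma)$ be a symmetric monoidal category; associativity and unit isomorphisms are suppressed. **Hopf algebras.** A *(non-associative) bialgebra* is an object $A$ with morphisms $m\colon A\otimes A\to A$, $u_A\colon I\to A$, $\Delta\colon A\to A\otimes A$, $\epsilon_A\colon A\to I$ such that $(A,\Delta,\epsilon_A)$ is a coassociative counital coalgebra, $u_A$ is a two-sided unit for $m$ (which need not be associative), and $\Delta$, $\epsilon_A$ preserve multiplication and unit. A *(non-associative) Hopf algebra* is a bialgebra with two morphisms $S_L,S_R\colon A\to A$, both antihomomorphisms of algebras and of coalgebras (units and counits being preserved), with $m(S_L\otimes 1)\Delta=u_A\epsilon_A=m(1\otimes S_R)\Delta$. Morphisms of Hopf algebras are the morphisms of algebras and of coalgebras that commute with $S_L$ and with $S_R$. **Actions.** An object of $\mathsf{Act}(\mathsf{Hopf}_{\mathcal C})$ consists of Hopf algebras $B,X$ and a morphism $\triangleright\colon B\otimes X\to X$ of $\mathcal C$ such that - $\triangleright(u_B\otimes 1_X)=1_X$ and $\triangleright(1_B\otimes u_X)=u_X\epsilon_B$; - $(1_B\otimes\triangleright)(\Delta\otimes 1_X)=(1_B\otimes\triangleright)(\sigma_{B,B}\otimes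 1_X)(\Delta\otimes 1_X)$; - $\epsilon_X\triangleright=\epsilon_B\otimes\epsilon_X$ and $\Delta\triangleright=(\triangleright\otimes\triangleright)(1_B\otimes\sigma_{B,X}\otimes 1_X)(\Delta\otimes\Delta)$; - $\triangleright(1_B\otimes\triangleright)=\triangleright(m\otimes 1_X)$; - $\triangleright(1_B\otimes m)=m(\triangleright\otimes\triangleright)(1_B\otimes\sigma_{B,X}\otimes 1_X)(\Delta\otimes 1_X\otimes 1_X)$; - $\triangleright(1_B\otimes S_L)=S_L\triangleright$ and $\triangleright(S_R\otimes S_R)(1_B\otimes\triangleright)(\Delta\otimes 1_X)=\epsilon_B\otimes S_R$. A morphism from $(B,X,\triangleright)$ to $(B',X',\triangleright')$ is a pair of Hopf algebra morphisms $g\colon B\to B'$, $v\colon X\to X'$ with $v\,\triangleright=\triangleright'(g\otimes v)$. **Split extensions.** An object of $\mathsf{SplitExt}(\mathsf{Hopf}_{\mathcal C})$ consists of Hopf algebras $X,A,B$, Hopf algebra morphisms $\kappa\colon X\to A$, $\alpha\colon A\to B$, $e\colon B\to A$, and a morphism $\lambda\colon A\to X$ of $\mathcal C$ such that, with $\triangleright:=\lambda\,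 m\,(e\otimes\kappa)$, - $(1')$ $\lambda\kappa=1_X$, $\alpha e=1_B$; $(2')$ $\lambda e=u_X\epsilon_B$, $\alpha\kappa=u_B\epsilon_X$; - $(3')$ $m(\kappa\lambda\otimes e\alpha)\Delta=1_A$; $(4')$ $\lambda m(\kappa\otimes e)=1_X\otimes\epsilon_B$; - $(5')$ $(1_B\otimes\triangleright)(\Delta\otimes 1_X)=(1_B\otimes\triangleright)(\sigma_{B,B}\otimes 1_X)(\Delta\otimes 1_X)$; - $(6')$–$(9')$ $m(m\otimes 1_A)f=m(1_A\otimes m)f$ for $f=\kappa\otimes e\otimes 1_A$, $\kappa\otimes 1_A\otimes e$, $1_A\otimes\kappa\otimes e$ and $e\otimes 1_A\otimes\kappa$ respectively; - $(10')$ $S_L\triangleright=\triangleright(1_B\otimes S_L)$; $(11')$ $\epsilon_B\otimes S_R=\triangleright(S_R\otimes S_R)(1_B\otimes\triangleright)(\Delta\otimes 1_X)$; - $(12')$ $\lambda$ is a morphism of coalgebras and $\lambda u_A=u_X$. A morphism from $(X,A,B,\kappa,\alpha,e,\lambda)$ to $(X',A',B',\kappa',\alpha',e',\lambda')$ is a triple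 of Hopf algebra morphisms $g\colon B\to B'$, $v\colon X\to X'$, $p\colon A\to A'$ with $p\kappa=\kappa'v$, $g\alpha=\alpha'p$, $pe=e'g$ and $v\lambda=\lambda'p$. **Theorem.** The categories $\mathsf{SplitExt}(\mathsf{Hopf}_{\mathcal C})$ and $\mathsf{Act}(\mathsf{Hopf}_{\mathcal C})$ are equivalent. More precisely, there is an equivalence, given by mutually quasi-inverse functors $F\colon\mathsf{SplitExt}(\mathsf{Hopf}_{\mathcal C})\to\mathsf{Act}(\mathsf{Hopf}_{\mathcal C})$ and $G\colon\mathsf{Act}(\mathsf{Hopf}_{\mathcal C})\to\mathsf{SplitExt}(\mathsf{Hopf}_{\mathcal C})$, where $F$ sends $(X,A,B,\kappa,\alpha,e,\lambda)$ to $(B,X,\lambda\, m\,(e\otimes\kappa))$ and $(g,v,p)$ to $(g,v)$, and where $G$ sends $(B,X,\triangleright)$ to $$\bigl(X,\ X\rtimes B,\ B,\ 1_X\otimes u_B,\ \epsilon_X\otimes 1_B,\ u_X\otimes 1_B,\ 1_X\otimes\epsilon_B\bigr)$$ and $(g,v)$ to $(g,v,v\otimes g)$. Here $X\rtimes B$ is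 the object $X\otimes B$ with, for $\Theta=(\triangleright\otimes 1_B)(1_B\otimes\sigma_{B,X})(\Delta\otimes 1_X)$, the structure $$m=(m\otimes m)(1_X\otimes\Theta\otimes 1_B),\quad u=u_X\otimes u_B,\quad \Delta=(1_X\otimes\sigma_{X,B}\otimes 1_B)(\Delta\otimes\Delta),\quad \epsilon=\epsilon_X\otimes\epsilon_B,$$ $$S_L=\Theta\,(S_L\otimes S_L)\,\sigma_{X,B},\qquad S_R=\Theta\,(S_R\otimes S_R)\,\sigma_{X,B},$$ which is a Hopf algebra. -/

import Mathlib

open CategoryTheory MonoidalCategory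
open scoped ComonObj

universe v u

namespace NonassocHopf

section HopfAlgebras

variable (C : Type u) [Category.{v} C] [MonoidalCategory C]

/-- The data of a non-associative Hopf algebra, without its laws: a (coassociative, counital)
coalgebra together with a unit, a multiplication and two endomorphisms. -/
structure HopfData where
  /-- The underlying object. -/
  X : C
  /-- The coalgebra structure. -/
  comon : ComonObj X
  /-- The unit. -/
  one : 𝟙_ C ⟶ X
  /-- The multiplication, not assumed to be associative. -/
  mul : X ⊗ X ⟶ X
  /-- The left antipode. -/
  SL : X ⟶ X
  /-- The right antipode. -/
  SR : X ⟶ X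

attribute [instance] HopfData.comon

variable {C}

section Laws

variable [SymmetricCategory C]

/-- The laws of a non-associative bialgebra: the multiplication is unital, and the
multiplication and the unit are compatible with the comultiplication and the counit. -/
structure HopfData.IsBialgebra (A : HopfData C) : Prop where
  one_mul : A.one ▷ A.X ≫ A.mul = (λ_ A.X).hom
  mul_one : A.X ◁ A.one ≫ A.mul = (ρ_ A.X).hom
  mul_comul : A.mul ≫ Δ[A.X] =
    (Δ[A.X] ⊗ₘ Δ[A.X]) ≫ tensorμ A.X A.X A.X A.X ≫ (A.mul ⊗ₘ A.mul)
  one_comul : A.one ≫ Δ[A.X] = (λ_ (𝟙_ C)).inv ≫ (A.one ⊗ₘ A.one)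
  mul_counit : A.mul ≫ ε[A.X] = (ε[A.X] ⊗ₘ ε[A.X]) ≫ (λ_ (𝟙_ C)).hom
  one_counit : A.one ≫ ε[A.X] = 𝟙 (𝟙_ C)

/-- `S` is an antihomomorphism of algebras and of coalgebras. -/
structure HopfData.IsAntihom (A : HopfData C) (S : A.X ⟶ A.X) : Prop where
  map_mul : A.mul ≫ S = (β_ A.X A.X).hom ≫ (S ⊗ₘ S) ≫ A.mul
  map_one : A.one ≫ S = A.one
  map_comul : S ≫ Δ[A.X] = Δ[A.X] ≫ (β_ A.X A.X).hom ≫ (S ⊗ₘ S)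
  map_counit : S ≫ ε[A.X] = ε[A.X]

/-- The laws of a non-associative Hopf algebra with a left and a right antipode. -/
structure HopfData.IsHopf (A : HopfData C) : Prop extends A.IsBialgebra where
  antihom_SL : A.IsAntihom A.SL
  antihom_SR : A.IsAntihom A.SR
  antipode_left : Δ[A.X] ≫ A.SL ▷ A.X ≫ A.mul = ε[A.X] ≫ A.one
  antipode_right : Δ[A.X] ≫ A.X ◁ A.SR ≫ A.mul = ε[A.X] ≫ A.one

end Laws

/-- `f` is a morphism of algebras and of coalgebras that preserves both antipodes. -/
structure IsHopfHom (A A' : HopfData C) (f : A.X ⟶ A'.X) : Prop where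
  map_mul : A.mul ≫ f = (f ⊗ₘ f) ≫ A'.mul
  map_one : A.one ≫ f = A'.one
  map_comul : f ≫ Δ[A'.X] = Δ[A.X] ≫ (f ⊗ₘ f)
  map_counit : f ≫ ε[A'.X] = ε[A.X]
  map_SL : A.SL ≫ f = f ≫ A'.SL
  map_SR : A.SR ≫ f = f ≫ A'.SR

theorem IsHopfHom.id (A : HopfData C) : IsHopfHom A A (𝟙 A.X) := by
  constructor <;> simp

theorem IsHopfHom.comp {A A' A'' : HopfData C} {f : A.X ⟶ A'.X} {g : A'.X ⟶ A''.X}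
    (hf : IsHopfHom A A' f) (hg : IsHopfHom A' A'' g) : IsHopfHom A A'' (f ≫ g) where
  map_mul := by rw [← Category.assoc, hf.map_mul, Category.assoc, hg.map_mul]; simp
  map_one := by rw [← Category.assoc, hf.map_one, hg.map_one]
  map_comul := by
    rw [Category.assoc, hg.map_comul, ← Category.assoc, hf.map_comul]; simp
  map_counit := by rw [Category.assoc, hg.map_counit, hf.map_counit]
  map_SL := by rw [← Category.assoc, hf.map_SL, Category.assoc, hg.map_SL, Category.assoc]
  map_SR := by rw [← Category.assoc, hf.map_SR, Category.assoc, hg.map_SR, Category.assoc]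

variable (C) in
/-- Non-associative Hopf algebras in the symmetric monoidal category `C`. -/
structure HopfAlg [SymmetricCategory C] extends HopfData C where
  isHopf : toHopfData.IsHopf

variable [SymmetricCategory C]

/-- Morphisms of Hopf algebras. -/
@[ext]
structure HopfAlg.Hom (A A' : HopfAlg C) where
  /-- The underlying morphism. -/
  hom : A.X ⟶ A'.X
  isHopfHom : IsHopfHom A.toHopfData A'.toHopfData hom

/-- The category of Hopf algebras in `C`. -/
instance : Category (HopfAlg C) where
  Hom := HopfAlg.Hom
  id A := ⟨𝟙 A.X, IsHopfHom.id _⟩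
  comp f g := ⟨f.hom ≫ g.hom, f.isHopfHom.comp g.isHopfHom⟩
  id_comp f := HopfAlg.Hom.ext (Category.id_comp f.hom)
  comp_id f := HopfAlg.Hom.ext (Category.comp_id f.hom)
  assoc f g h := HopfAlg.Hom.ext (Category.assoc f.hom g.hom h.hom)

end HopfAlgebras

variable {C : Type u} [Category.{v} C] [MonoidalCategory C] [SymmetricCategory C]

section Actions

/-- An action of the Hopf algebra `B` on the Hopf algebra `X`: an action of bialgebras (the
first four fields) with the additional conditions on an action of Hopf algebras. -/
structure IsAction (B X : HopfAlg C) (act : B.X ⊗ X.X ⟶ X.X) : Prop where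
  one_act : B.one ▷ X.X ≫ act = (λ_ X.X).hom
  act_one : B.X ◁ X.one ≫ act = (ρ_ B.X).hom ≫ ε[B.X] ≫ X.one
  comul_act : Δ[B.X] ▷ X.X ≫ (α_ B.X B.X X.X).hom ≫ B.X ◁ act =
    Δ[B.X] ▷ X.X ≫ (β_ B.X B.X).hom ▷ X.X ≫ (α_ B.X B.X X.X).hom ≫ B.X ◁ act
  /-- The action is a morphism of coalgebras on the tensor product coalgebra. -/
  isComonHom : IsComonHom act
  mul_act : B.mul ▷ X.X ≫ act = (α_ B.X B.X X.X).hom ≫ B.X ◁ act ≫ act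
  act_mul : B.X ◁ X.mul ≫ act =
    Δ[B.X] ▷ (X.X ⊗ X.X) ≫ tensorμ B.X B.X X.X X.X ≫ (act ⊗ₘ act) ≫ X.mul
  act_SL : B.X ◁ X.SL ≫ act = act ≫ X.SL
  act_SR : Δ[B.X] ▷ X.X ≫ (α_ B.X B.X X.X).hom ≫ B.X ◁ act ≫ (B.SR ⊗ₘ X.SR) ≫ act =
    ε[B.X] ▷ X.X ≫ (λ_ X.X).hom ≫ X.SR

variable (C) in
/-- Actions of Hopf algebras in `C`. -/
structure Act where
  /-- The Hopf algebra that acts. -/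
  B : HopfAlg C
  /-- The Hopf algebra that is acted on. -/
  X : HopfAlg C
  /-- The action. -/
  act : B.X ⊗ X.X ⟶ X.X
  isAction : IsAction B X act

/-- Morphisms of actions of Hopf algebras. -/
@[ext]
structure Act.Hom (T T' : Act C) where
  /-- The morphism between the acting Hopf algebras. -/
  g : T.B ⟶ T'.B
  /-- The morphism between the Hopf algebras acted on. -/
  v : T.X ⟶ T'.X
  comm : T.act ≫ v.hom = (g.hom ⊗ₘ v.hom) ≫ T'.act

/-- The category of actions of Hopf algebras in `C`. -/
instance : Category (Act C) where
  Hom := Act.Hom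
  id T := ⟨𝟙 T.B, 𝟙 T.X, by
    change T.act ≫ 𝟙 _ = (𝟙 _ ⊗ₘ 𝟙 _) ≫ T.act
    simp⟩
  comp {T T' T''} f h := ⟨f.g ≫ h.g, f.v ≫ h.v, by
    change T.act ≫ f.v.hom ≫ h.v.hom =
      ((f.g.hom ≫ h.g.hom) ⊗ₘ (f.v.hom ≫ h.v.hom)) ≫ T''.act
    rw [← Category.assoc, f.comm, Category.assoc, h.comm]
    simp⟩
  id_comp f := Act.Hom.ext (Category.id_comp f.g) (Category.id_comp f.v)
  comp_id f := Act.Hom.ext (Category.comp_id f.g) (Category.comp_id f.v)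
  assoc f h k := Act.Hom.ext (Category.assoc f.g h.g k.g) (Category.assoc f.v h.v k.v)

variable (C) in
/-- The functor `(B, X, act) ↦ (B, X)`, `(g, v) ↦ (g, v)`. -/
def Act.ends : Act C ⥤ HopfAlg C × HopfAlg C where
  obj T := (T.B, T.X)
  map f := (f.g, f.v)
  map_id _ := rfl
  map_comp _ _ := rfl

variable (C) in
/-- The functor `(B, X, act) ↦ X ⊗ B`, `(g, v) ↦ v ⊗ g`. -/
def Act.tensor : Act C ⥤ C where
  obj T := T.X.X ⊗ T.B.X
  map f := f.v.hom ⊗ₘ f.g.hom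
  map_id T := id_tensorHom_id T.X.X T.B.X
  map_comp f h := (tensorHom_comp_tensorHom f.v.hom f.g.hom h.v.hom h.g.hom).symm

end Actions

section SplitExtensions

/-- The morphism `lam ∘ m ∘ (e ⊗ κ) : B ⊗ X ⟶ X`. -/
def extAct {X A B : HopfAlg C} (κ : X ⟶ A) (e : B ⟶ A) (lam : A.X ⟶ X.X) :
    B.X ⊗ X.X ⟶ X.X :=
  (e.hom ⊗ₘ κ.hom) ≫ A.mul ≫ lam

/-- The conditions on a split extension of Hopf algebras `X ⟶ A ⇄ B`, where `lam : A ⟶ X` is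
only a morphism in `C`. -/
structure IsSplitExt {X A B : HopfAlg C} (κ : X ⟶ A) (α : A ⟶ B) (e : B ⟶ A)
    (lam : A.X ⟶ X.X) : Prop where
  κ_lam : κ.hom ≫ lam = 𝟙 X.X
  e_α : e ≫ α = 𝟙 B
  e_lam : e.hom ≫ lam = ε[B.X] ≫ X.one
  κ_α : κ.hom ≫ α.hom = ε[X.X] ≫ B.one
  decomp : Δ[A.X] ≫ ((lam ≫ κ.hom) ⊗ₘ (α.hom ≫ e.hom)) ≫ A.mul = 𝟙 A.X
  lam_mul : (κ.hom ⊗ₘ e.hom) ≫ A.mul ≫ lam = X.X ◁ ε[B.X] ≫ (ρ_ X.X).hom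
  comul_extAct :
    Δ[B.X] ▷ X.X ≫ (α_ B.X B.X X.X).hom ≫ B.X ◁ extAct κ e lam =
      Δ[B.X] ▷ X.X ≫ (β_ B.X B.X).hom ▷ X.X ≫ (α_ B.X B.X X.X).hom ≫ B.X ◁ extAct κ e lam
  assoc_κ_e_id :
    ((κ.hom ⊗ₘ e.hom) ⊗ₘ 𝟙 A.X) ≫ A.mul ▷ A.X ≫ A.mul =
      ((κ.hom ⊗ₘ e.hom) ⊗ₘ 𝟙 A.X) ≫ (α_ A.X A.X A.X).hom ≫ A.X ◁ A.mul ≫ A.mul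
  assoc_κ_id_e :
    ((κ.hom ⊗ₘ 𝟙 A.X) ⊗ₘ e.hom) ≫ A.mul ▷ A.X ≫ A.mul =
      ((κ.hom ⊗ₘ 𝟙 A.X) ⊗ₘ e.hom) ≫ (α_ A.X A.X A.X).hom ≫ A.X ◁ A.mul ≫ A.mul
  assoc_id_κ_e :
    ((𝟙 A.X ⊗ₘ κ.hom) ⊗ₘ e.hom) ≫ A.mul ▷ A.X ≫ A.mul =
      ((𝟙 A.X ⊗ₘ κ.hom) ⊗ₘ e.hom) ≫ (α_ A.X A.X A.X).hom ≫ A.X ◁ A.mul ≫ A.mul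
  assoc_e_id_κ :
    ((e.hom ⊗ₘ 𝟙 A.X) ⊗ₘ κ.hom) ≫ A.mul ▷ A.X ≫ A.mul =
      ((e.hom ⊗ₘ 𝟙 A.X) ⊗ₘ κ.hom) ≫ (α_ A.X A.X A.X).hom ≫ A.X ◁ A.mul ≫ A.mul
  extAct_SL : extAct κ e lam ≫ X.SL = B.X ◁ X.SL ≫ extAct κ e lam
  extAct_SR :
    ε[B.X] ▷ X.X ≫ (λ_ X.X).hom ≫ X.SR =
      Δ[B.X] ▷ X.X ≫ (α_ B.X B.X X.X).hom ≫ B.X ◁ extAct κ e lam ≫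
        (B.SR ⊗ₘ X.SR) ≫ extAct κ e lam
  isComonHom_lam : IsComonHom lam
  one_lam : A.one ≫ lam = X.one

variable (C) in
/-- Split extensions of Hopf algebras in `C`. -/
structure SplitExt where
  /-- The kernel object. -/
  X : HopfAlg C
  /-- The total object. -/
  A : HopfAlg C
  /-- The base object. -/
  B : HopfAlg C
  /-- The inclusion. -/
  κ : X ⟶ A
  /-- The projection. -/
  α : A ⟶ B
  /-- The section. -/
  e : B ⟶ A
  /-- The retraction of `κ`, a morphism in `C`. -/
  lam : A.X ⟶ X.X
  isSplitExt : IsSplitExt κ α e lam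

/-- Morphisms of split extensions of Hopf algebras. -/
@[ext]
structure SplitExt.Hom (S S' : SplitExt C) where
  /-- The morphism between the base objects. -/
  g : S.B ⟶ S'.B
  /-- The morphism between the kernel objects. -/
  v : S.X ⟶ S'.X
  /-- The morphism between the total objects. -/
  p : S.A ⟶ S'.A
  comm_κ : S.κ ≫ p = v ≫ S'.κ
  comm_α : S.α ≫ g = p ≫ S'.α
  comm_e : S.e ≫ p = g ≫ S'.e
  comm_lam : S.lam ≫ v.hom = p.hom ≫ S'.lam

/-- The category of split extensions of Hopf algebras in `C`. -/
instance : Category (SplitExt C) where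
  Hom := SplitExt.Hom
  id S :=
    { g := 𝟙 S.B
      v := 𝟙 S.X
      p := 𝟙 S.A
      comm_κ := by simp
      comm_α := by simp
      comm_e := by simp
      comm_lam := (Category.comp_id S.lam).trans (Category.id_comp S.lam).symm }
  comp {S S' S''} f h :=
    { g := f.g ≫ h.g
      v := f.v ≫ h.v
      p := f.p ≫ h.p
      comm_κ := by
        rw [← Category.assoc, f.comm_κ, Category.assoc, h.comm_κ, Category.assoc]
      comm_α := by
        rw [← Category.assoc, f.comm_α, Category.assoc, h.comm_α, Category.assoc]
      comm_e := by
        rw [← Category.assoc, f.comm_e, Category.assoc, h.comm_e, Category.assoc]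
      comm_lam := by
        change S.lam ≫ f.v.hom ≫ h.v.hom = (f.p.hom ≫ h.p.hom) ≫ S''.lam
        rw [← Category.assoc, f.comm_lam, Category.assoc, h.comm_lam, Category.assoc] }
  id_comp f := SplitExt.Hom.ext (Category.id_comp f.g) (Category.id_comp f.v)
    (Category.id_comp f.p)
  comp_id f := SplitExt.Hom.ext (Category.comp_id f.g) (Category.comp_id f.v)
    (Category.comp_id f.p)
  assoc f h k := SplitExt.Hom.ext (Category.assoc f.g h.g k.g) (Category.assoc f.v h.v k.v)
    (Category.assoc f.p h.p k.p)

variable (C) in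
/-- The functor sending a split extension to `(B, X)` and `(g, v, p)` to `(g, v)`. -/
def SplitExt.ends : SplitExt C ⥤ HopfAlg C × HopfAlg C where
  obj S := (S.B, S.X)
  map f := (f.g, f.v)
  map_id _ := rfl
  map_comp _ _ := rfl

variable (C) in
/-- The functor sending a split extension to the object of `C` underlying its total object `A`
and `(g, v, p)` to `p`. -/
def SplitExt.total : SplitExt C ⥤ C where
  obj S := S.A.X
  map f := f.p.hom
  map_id _ := rfl
  map_comp _ _ := rfl

end SplitExtensions

section SemidirectProducts

namespace Act

variable (T : Act C)

/-- The morphism `B ⊗ X ⟶ X ⊗ B` given in Sweedler notation by `b ⊗ x ↦ (b₁ ▷ x) ⊗ b₂`. -/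
def theta : T.B.X ⊗ T.X.X ⟶ T.X.X ⊗ T.B.X :=
  Δ[T.B.X] ▷ T.X.X ≫ (α_ T.B.X T.B.X T.X.X).hom ≫ T.B.X ◁ (β_ T.B.X T.X.X).hom ≫
    (α_ T.B.X T.X.X T.B.X).inv ≫ T.act ▷ T.B.X

/-- The semidirect product of `X` and `B`, on the tensor product coalgebra `X ⊗ B`. -/
def semidirect : HopfData C where
  X := T.X.X ⊗ T.B.X
  comon := inferInstance
  one := (λ_ (𝟙_ C)).inv ≫ (T.X.one ⊗ₘ T.B.one)
  mul := (α_ T.X.X T.B.X (T.X.X ⊗ T.B.X)).hom ≫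
    T.X.X ◁ ((α_ T.B.X T.X.X T.B.X).inv ≫ T.theta ▷ T.B.X ≫ (α_ T.X.X T.B.X T.B.X).hom) ≫
    (α_ T.X.X T.X.X (T.B.X ⊗ T.B.X)).inv ≫ (T.X.mul ⊗ₘ T.B.mul)
  SL := (β_ T.X.X T.B.X).hom ≫ (T.B.SL ⊗ₘ T.X.SL) ≫ T.theta
  SR := (β_ T.X.X T.B.X).hom ≫ (T.B.SR ⊗ₘ T.X.SR) ≫ T.theta

/-- The inclusion `1 ⊗ u : X ⟶ X ⊗ B`. -/
def inl : T.X.X ⟶ T.semidirect.X := (ρ_ T.X.X).inv ≫ T.X.X ◁ T.B.one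

/-- The inclusion `u ⊗ 1 : B ⟶ X ⊗ B`. -/
def inr : T.B.X ⟶ T.semidirect.X := (λ_ T.B.X).inv ≫ T.X.one ▷ T.B.X

/-- The projection `1 ⊗ ε : X ⊗ B ⟶ X`. -/
def fst : T.semidirect.X ⟶ T.X.X := T.X.X ◁ ε[T.B.X] ≫ (ρ_ T.X.X).hom

/-- The projection `ε ⊗ 1 : X ⊗ B ⟶ B`. -/
def snd : T.semidirect.X ⟶ T.B.X := ε[T.X.X] ▷ T.B.X ≫ (λ_ T.B.X).hom

end Act

end SemidirectProducts

end NonassocHopf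

/-!
Every identity between morphisms is checked on generalized elements. For a comonoid `D` and
morphisms `f : D ⟶ X`, `g : D ⟶ Y`, the pairing `pair f g = Δ ≫ (f ⊗ g)` reads `d ↦ f(d₁) ⊗ g(d₂)`;
pairings are associative and natural, and a homomorphism of comonoids may be moved inside them.
Since `D` is not cocommutative, the order of the entries matters: two of them may be exchanged only
if they commute (`Commutes`). The projections of a tensor product of comonoids are commuting
homomorphisms of comonoids whose pairing is the identity, so a morphism out of a tensor product is
determined by its values on pairings of commuting homomorphisms (`hom_ext_pair` and its variants).
On such elements the computations are those one writes in Sweedler notation.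

*From actions to split extensions.* The condition `b₁ ⊗ (b₂ ▷ x) = b₂ ⊗ (b₁ ▷ x)` says that `b`
commutes with `b ▷ x`. Hence `Θ(b ⊗ x) = (b ▷ x) ⊗ b` as a pairing, not only for homomorphisms `b`
of comonoids but also for antihomomorphisms such as `S b` (`Act.pair_theta`). With this, the
multiplication `(x ⊗ b)(y ⊗ c) = x (b ▷ y) ⊗ b c` is a pairing of two commuting homomorphisms of
comonoids, so it is one itself. Both antipodes satisfy `S b₁ ▷ S(b₂ ▷ x) = ε(b) S x`
(`Act.AntipodeCompatible`), which is the cancellation that makes `Θ(S b ⊗ S x)` an antihomomorphism.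
Three elements of the semidirect product associate as soon as certain triples in `X` and in `B` do
(`Act.semidirectMul_assoc`); in the four partial associativity laws of a split extension one entry
of each of these triples is the unit.

*From split extensions to actions.* The decomposition `a = κλ(a₁) eα(a₂)` for `a = e(b) κ(x)` is the
exchange law `e(b) κ(x) = κ(b ▷ x) e(b)` (`IsSplitExt.exchange`). Together with the four
partial associativity laws it moves every `κ` to the left of every `e`, after which `λ` reads off
the action axioms. The same rewriting shows that `x ⊗ b ↦ κ(x) e(b)` is a morphism of Hopf algebras
from the semidirect product to `A`, with inverse `a ↦ λ(a₁) ⊗ α(a₂)`. It is the component of the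
isomorphism between the identity and one composite of the two functors; the other composite returns
the action unchanged.
-/

namespace NonassocHopf

/-! ### Pairings and commuting morphisms out of a comonoid -/

section Pairing

variable {C : Type u} [Category.{v} C] [MonoidalCategory C]
variable {D E X Y Z X' Y' W : C} [ComonObj D] [ComonObj E]

/-- The pairing `Δ ≫ (f ⊗ g)` of two morphisms out of a comonoid; in Sweedler notation,
`d ↦ f(d₁) ⊗ g(d₂)`. -/
def pair (f : D ⟶ X) (g : D ⟶ Y) : D ⟶ X ⊗ Y := Δ[D] ≫ (f ⊗ₘ g)

@[simp]
theorem pair_tensorHom (f : D ⟶ X) (g : D ⟶ Y) (h : X ⟶ X') (k : Y ⟶ Y') :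
    pair f g ≫ (h ⊗ₘ k) = pair (f ≫ h) (g ≫ k) := by
  simp [pair]

@[simp]
theorem pair_tensorHom_assoc (f : D ⟶ X) (g : D ⟶ Y) (h : X ⟶ X') (k : Y ⟶ Y')
    (l : X' ⊗ Y' ⟶ W) : pair f g ≫ (h ⊗ₘ k) ≫ l = pair (f ≫ h) (g ≫ k) ≫ l := by
  rw [← Category.assoc, pair_tensorHom]

@[simp]
theorem pair_whiskerRight (f : D ⟶ X) (g : D ⟶ Y) (h : X ⟶ X') :
    pair f g ≫ h ▷ Y = pair (f ≫ h) g := by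
  simp [← tensorHom_id]

@[simp]
theorem pair_whiskerRight_assoc (f : D ⟶ X) (g : D ⟶ Y) (h : X ⟶ X') (l : X' ⊗ Y ⟶ W) :
    pair f g ≫ h ▷ Y ≫ l = pair (f ≫ h) g ≫ l := by
  rw [← Category.assoc, pair_whiskerRight]

@[simp]
theorem pair_whiskerLeft (f : D ⟶ X) (g : D ⟶ Y) (k : Y ⟶ Y') :
    pair f g ≫ X ◁ k = pair f (g ≫ k) := by
  simp [← id_tensorHom]

@[simp]
theorem pair_whiskerLeft_assoc (f : D ⟶ X) (g : D ⟶ Y) (k : Y ⟶ Y') (l : X ⊗ Y' ⟶ W) :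
    pair f g ≫ X ◁ k ≫ l = pair f (g ≫ k) ≫ l := by
  rw [← Category.assoc, pair_whiskerLeft]

@[simp]
theorem pair_associator (f : D ⟶ X) (g : D ⟶ Y) (h : D ⟶ Z) :
    pair (pair f g) h ≫ (α_ X Y Z).hom = pair f (pair g h) := by
  have h1 : pair (pair f g) h = Δ[D] ≫ Δ[D] ▷ D ≫ ((f ⊗ₘ g) ⊗ₘ h) := by
    simp only [pair, ← tensorHom_id, tensorHom_comp_tensorHom, Category.id_comp]
  have h2 : pair f (pair g h) = Δ[D] ≫ D ◁ Δ[D] ≫ (f ⊗ₘ (g ⊗ₘ h)) := by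
    simp only [pair, ← id_tensorHom, tensorHom_comp_tensorHom, Category.id_comp]
  rw [h1, h2]
  simp only [Category.assoc, associator_naturality, ComonObj.comul_assoc_assoc]

@[simp]
theorem pair_associator_assoc (f : D ⟶ X) (g : D ⟶ Y) (h : D ⟶ Z) (l : X ⊗ Y ⊗ Z ⟶ W) :
    pair (pair f g) h ≫ (α_ X Y Z).hom ≫ l = pair f (pair g h) ≫ l := by
  rw [← Category.assoc, pair_associator]

@[simp]
theorem pair_associator_inv (f : D ⟶ X) (g : D ⟶ Y) (h : D ⟶ Z) :
    pair f (pair g h) ≫ (α_ X Y Z).inv = pair (pair f g) h := by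
  rw [← pair_associator, Category.assoc, Iso.hom_inv_id, Category.comp_id]

@[simp]
theorem pair_associator_inv_assoc (f : D ⟶ X) (g : D ⟶ Y) (h : D ⟶ Z) (l : (X ⊗ Y) ⊗ Z ⟶ W) :
    pair f (pair g h) ≫ (α_ X Y Z).inv ≫ l = pair (pair f g) h ≫ l := by
  rw [← Category.assoc, pair_associator_inv]

theorem pair_counit_left (f : D ⟶ X) : pair ε[D] f = f ≫ (λ_ X).inv := by
  simp [pair]

theorem pair_counit_right (f : D ⟶ X) : pair f ε[D] = f ≫ (ρ_ X).inv := by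
  simp [pair]

@[simp]
theorem pair_counit_leftUnitor (f : D ⟶ X) : pair ε[D] f ≫ (λ_ X).hom = f := by
  simp [pair_counit_left]

@[simp]
theorem pair_counit_leftUnitor_assoc (f : D ⟶ X) (l : X ⟶ W) :
    pair ε[D] f ≫ (λ_ X).hom ≫ l = f ≫ l := by
  rw [← Category.assoc, pair_counit_leftUnitor]

@[simp]
theorem pair_counit_rightUnitor (f : D ⟶ X) : pair f ε[D] ≫ (ρ_ X).hom = f := by
  simp [pair_counit_right]

@[simp]
theorem pair_counit_rightUnitor_assoc (f : D ⟶ X) (l : X ⟶ W) :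
    pair f ε[D] ≫ (ρ_ X).hom ≫ l = f ≫ l := by
  rw [← Category.assoc, pair_counit_rightUnitor]

theorem comp_pair (h : D ⟶ E) [IsComonHom h] (f : E ⟶ X) (g : E ⟶ Y) :
    h ≫ pair f g = pair (h ≫ f) (h ≫ g) := by
  simp [pair]

theorem comul_eq_pair : Δ[D] = pair (𝟙 D) (𝟙 D) := by simp [pair]

theorem comp_comul (h : D ⟶ E) [IsComonHom h] : h ≫ Δ[E] = pair h h := by
  simp [pair]

theorem isComonHom_of_pair {h : D ⟶ E} (h₁ : h ≫ ε[E] = ε[D]) (h₂ : h ≫ Δ[E] = pair h h) :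
    IsComonHom h := ⟨h₁, h₂⟩

/-- The projection of a tensor product onto its left factor, given by the counit of the right
factor. -/
def projLeft (X Y : C) [ComonObj Y] : X ⊗ Y ⟶ X := X ◁ ε[Y] ≫ (ρ_ X).hom

/-- The projection of a tensor product onto its right factor, given by the counit of the left
factor. -/
def projRight (X Y : C) [ComonObj X] : X ⊗ Y ⟶ Y := ε[X] ▷ Y ≫ (λ_ Y).hom

theorem pair_projRight_of_counit [ComonObj X] {f : D ⟶ X} {g : D ⟶ Y} (h : f ≫ ε[X] = ε[D]) :
    pair f g ≫ projRight X Y = g := by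
  simp [projRight, h]

@[simp]
theorem pair_projLeft [ComonObj Y] {f : D ⟶ X} {g : D ⟶ Y} [IsComonHom g] :
    pair f g ≫ projLeft X Y = f := by
  simp [projLeft]

@[simp]
theorem pair_projRight [ComonObj X] {f : D ⟶ X} {g : D ⟶ Y} [IsComonHom f] :
    pair f g ≫ projRight X Y = g := by
  simp [projRight]

end Pairing

section Braided

variable {C : Type u} [Category.{v} C] [MonoidalCategory C] [BraidedCategory C]
variable {D E X Y Z X' Y' : C} [ComonObj D] [ComonObj E]

/-- The pairing over a tensor product of comonoids of two morphisms that are themselves tensor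
products. -/
theorem pair_tensorHom_tensorHom (f : D ⟶ X) (g : E ⟶ Y) (f' : D ⟶ X')
    (g' : E ⟶ Y') : pair (f ⊗ₘ g) (f' ⊗ₘ g') = (pair f f' ⊗ₘ pair g g') ≫ tensorμ X X' Y Y' := by
  simp only [pair, Comon.tensorObj_comul, Category.assoc]
  rw [← tensorμ_natural, tensorHom_comp_tensorHom_assoc]

theorem isComonHom_tensorHom [ComonObj X] [ComonObj Y] (f : D ⟶ X) (g : E ⟶ Y)
    [IsComonHom f] [IsComonHom g] : IsComonHom (f ⊗ₘ g) := isComonHom_of_pair (by simp) (by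
  rw [pair_tensorHom_tensorHom, ← comp_comul, ← comp_comul, Comon.tensorObj_comul,
    tensorHom_comp_tensorHom_assoc])

variable (X Y) [ComonObj X] [ComonObj Y]

/-- The two projections pair to the identity: this is the counit law on each factor. -/
theorem pair_proj : pair (projLeft X Y) (projRight X Y) = 𝟙 (X ⊗ Y) := by
  have h : pair (projLeft X Y) (projRight X Y) =
      pair (𝟙 X ⊗ₘ ε[Y]) (ε[X] ⊗ₘ 𝟙 Y) ≫ ((ρ_ X).hom ⊗ₘ (λ_ Y).hom) := by
    simp [projLeft, projRight]
  rw [h, pair_tensorHom_tensorHom, (pair_counit_left (𝟙 Y) :), (pair_counit_right (𝟙 X) :)]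
  simp only [tensorμ, braiding_tensorUnit_left]
  monoidal

/-- Pairing the two projections in the opposite order gives the braiding. -/
theorem pair_proj' : pair (projRight X Y) (projLeft X Y) = (β_ X Y).hom := by
  have h : pair (projRight X Y) (projLeft X Y) =
      pair (ε[X] ⊗ₘ 𝟙 Y) (𝟙 X ⊗ₘ ε[Y]) ≫ ((λ_ Y).hom ⊗ₘ (ρ_ X).hom) := by
    simp [projLeft, projRight]
  rw [h, pair_tensorHom_tensorHom, (pair_counit_left (𝟙 X) :), (pair_counit_right (𝟙 Y) :)]
  simp only [tensorμ]
  monoidal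

instance : IsComonHom (projLeft X Y) := isComonHom_of_pair
  (by simp [projLeft, MonoidalCategory.tensorHom_def']; monoidal) (by
    have h : pair (projLeft X Y) (projLeft X Y) =
        pair (𝟙 X ⊗ₘ ε[Y]) (𝟙 X ⊗ₘ ε[Y]) ≫ ((ρ_ X).hom ⊗ₘ (ρ_ X).hom) := by
      simp [projLeft]
    rw [h, pair_tensorHom_tensorHom, (pair_counit_left ε[Y] :), ← comul_eq_pair]
    have h' : (Δ[X] ⊗ₘ ε[Y] ≫ (λ_ (𝟙_ C)).inv) = (Δ[X] ⊗ₘ ε[Y]) ≫ (X ⊗ X) ◁ (λ_ (𝟙_ C)).inv := by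
      simp [← id_tensorHom]
    rw [h', Category.assoc, Category.assoc, ← tensor_right_unitality, projLeft,
      MonoidalCategory.tensorHom_def']
    simp)

instance : IsComonHom (projRight X Y) := isComonHom_of_pair
  (by simp [projRight, MonoidalCategory.tensorHom_def]) (by
    have h : pair (projRight X Y) (projRight X Y) =
        pair (ε[X] ⊗ₘ 𝟙 Y) (ε[X] ⊗ₘ 𝟙 Y) ≫ ((λ_ Y).hom ⊗ₘ (λ_ Y).hom) := by
      simp [projRight]
    rw [h, pair_tensorHom_tensorHom, (pair_counit_left ε[X] :), ← comul_eq_pair]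
    have h' : (ε[X] ≫ (λ_ (𝟙_ C)).inv ⊗ₘ Δ[Y]) = (ε[X] ⊗ₘ Δ[Y]) ≫ (λ_ (𝟙_ C)).inv ▷ (Y ⊗ Y) := by
      simp [← tensorHom_id]
    rw [h', Category.assoc, Category.assoc, ← tensor_left_unitality, projRight,
      MonoidalCategory.tensorHom_def]
    simp)

variable {X Y}

theorem tensorHom_eq_pair (f : X ⟶ X') (g : Y ⟶ Y') :
    f ⊗ₘ g = pair (projLeft X Y ≫ f) (projRight X Y ≫ g) := by
  rw [← pair_tensorHom, pair_proj, Category.id_comp]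

end Braided

section Symmetric

variable {C : Type u} [Category.{v} C] [MonoidalCategory C] [SymmetricCategory C]
variable {D E X Y Z X' Y' W : C} [ComonObj D] [ComonObj E]

/-- Two morphisms `f` and `g` out of a comonoid commute if `f(d₁) ⊗ g(d₂) = f(d₂) ⊗ g(d₁)` in
Sweedler notation. -/
def Commutes (f : D ⟶ X) (g : D ⟶ Y) : Prop := pair f g ≫ (β_ X Y).hom = pair g f

namespace Commutes

variable {f : D ⟶ X} {g : D ⟶ Y} {h : D ⟶ Z}

theorem eq (w : Commutes f g) : pair f g ≫ (β_ X Y).hom = pair g f := w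

theorem symm (w : Commutes f g) : Commutes g f := by
  rw [Commutes, ← w.eq]; simp

theorem comp (w : Commutes f g) (k : X ⟶ X') (l : Y ⟶ Y') : Commutes (f ≫ k) (g ≫ l) := by
  rw [Commutes, ← pair_tensorHom, ← pair_tensorHom, Category.assoc,
    BraidedCategory.braiding_naturality, ← w.eq, Category.assoc]

theorem comp_left (w : Commutes f g) (k : X ⟶ X') : Commutes (f ≫ k) g := by
  simpa using w.comp k (𝟙 Y)

theorem comp_right (w : Commutes f g) (l : Y ⟶ Y') : Commutes f (g ≫ l) := by
  simpa using w.comp (𝟙 X) l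

theorem precomp (w : Commutes f g) (k : E ⟶ D) [IsComonHom k] : Commutes (k ≫ f) (k ≫ g) := by
  rw [Commutes, ← comp_pair, ← comp_pair, Category.assoc, w.eq]

theorem pair_right (w : Commutes f g) (w' : Commutes f h) : Commutes f (pair g h) := by
  rw [Commutes, BraidedCategory.braiding_tensor_right_hom, pair_associator_inv_assoc,
    pair_whiskerRight_assoc, w.eq, pair_associator_assoc, pair_whiskerLeft_assoc, w'.eq,
    pair_associator_inv]

theorem pair_left (w : Commutes f h) (w' : Commutes g h) : Commutes (pair f g) h :=
  (w.symm.pair_right w'.symm).symm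

theorem proj (X Y : C) [ComonObj X] [ComonObj Y] : Commutes (projLeft X Y) (projRight X Y) := by
  rw [Commutes, pair_proj, pair_proj', Category.id_comp]

theorem counit_left (f : D ⟶ X) : Commutes ε[D] f := by
  rw [Commutes, pair_counit_left, pair_counit_right]
  simp

end Commutes

/-- The interchange `tensorμ` exchanges the two inner entries of a fourfold pairing. -/
theorem pair_pair_tensorμ {f : D ⟶ X} {g : D ⟶ Y} {h : D ⟶ Z} {k : D ⟶ W} (w : Commutes g h) :
    pair (pair f g) (pair h k) ≫ tensorμ X Y Z W = pair (pair f h) (pair g k) := by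
  simp only [tensorμ, pair_associator_assoc, pair_whiskerLeft_assoc, pair_associator_inv,
    pair_whiskerRight, w.eq, pair_associator]

theorem pair_pair_tensorμ_assoc {f : D ⟶ X} {g : D ⟶ Y} {h : D ⟶ Z} {k : D ⟶ W}
    (w : Commutes g h) {V : C} (l : (X ⊗ Z) ⊗ Y ⊗ W ⟶ V) :
    pair (pair f g) (pair h k) ≫ tensorμ X Y Z W ≫ l = pair (pair f h) (pair g k) ≫ l := by
  rw [← Category.assoc, pair_pair_tensorμ w]

/-- Two morphisms out of `X ⊗ Y` agree if they agree on all pairs of commuting homomorphisms of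
comonoids; such pairs serve as generalized elements. -/
theorem hom_ext_pair [ComonObj X] [ComonObj Y] {p q : X ⊗ Y ⟶ W}
    (h : ∀ (D : C) [ComonObj D] (x : D ⟶ X) (y : D ⟶ Y) [IsComonHom x] [IsComonHom y],
      Commutes x y → pair x y ≫ p = pair x y ≫ q) : p = q := by
  simpa [pair_proj] using h _ _ _ (Commutes.proj X Y)

/-- A homomorphism of comonoids into a tensor product is a pairing of commuting homomorphisms. -/
theorem exists_eq_pair [ComonObj X] [ComonObj Y] (h : D ⟶ X ⊗ Y) [IsComonHom h] :
    ∃ (x : D ⟶ X) (y : D ⟶ Y), IsComonHom x ∧ IsComonHom y ∧ Commutes x y ∧ h = pair x y :=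
  ⟨h ≫ projLeft X Y, h ≫ projRight X Y, inferInstance, inferInstance,
    (Commutes.proj X Y).precomp h, by rw [← comp_pair, pair_proj, Category.comp_id]⟩

theorem hom_ext_pair_pair_left [ComonObj X] [ComonObj Y] [ComonObj Z] {p q : (X ⊗ Y) ⊗ Z ⟶ W}
    (h : ∀ (D : C) [ComonObj D] (x : D ⟶ X) (y : D ⟶ Y) (z : D ⟶ Z)
      [IsComonHom x] [IsComonHom y] [IsComonHom z],
      Commutes x y → Commutes x z → Commutes y z →
        pair (pair x y) z ≫ p = pair (pair x y) z ≫ q) : p = q :=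
  hom_ext_pair fun D _ xy z _ _ w => by
    have h' := h D (xy ≫ projLeft X Y) (xy ≫ projRight X Y) z
      ((Commutes.proj X Y).precomp xy) (w.comp_left _) (w.comp_left _)
    simpa only [← comp_pair, pair_proj, Category.comp_id] using h'

theorem hom_ext_pair_pair [ComonObj X] [ComonObj Y] [ComonObj X'] [ComonObj Y']
    {p q : (X ⊗ Y) ⊗ (X' ⊗ Y') ⟶ W}
    (h : ∀ (D : C) [ComonObj D] (x : D ⟶ X) (y : D ⟶ Y) (x' : D ⟶ X') (y' : D ⟶ Y')
      [IsComonHom x] [IsComonHom y] [IsComonHom x'] [IsComonHom y'],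
      Commutes x y → Commutes x x' → Commutes x y' → Commutes y x' → Commutes y y' →
      Commutes x' y' →
        pair (pair x y) (pair x' y') ≫ p = pair (pair x y) (pair x' y') ≫ q) : p = q :=
  hom_ext_pair_pair_left fun D _ x y z _ _ _ hxy hxz hyz => by
    have h' := h D x y (z ≫ projLeft X' Y') (z ≫ projRight X' Y') hxy (hxz.comp_right _)
      (hxz.comp_right _) (hyz.comp_right _) (hyz.comp_right _) ((Commutes.proj X' Y').precomp z)
    simpa only [← comp_pair, pair_proj, Category.comp_id] using h'

/-- Without cocommutativity, a pairing of homomorphisms of comonoids need not be one; it is if the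
two entries commute. -/
theorem isComonHom_pair [ComonObj X] [ComonObj Y] {f : D ⟶ X} {g : D ⟶ Y}
    [IsComonHom f] [IsComonHom g] (w : Commutes f g) : IsComonHom (pair f g) := isComonHom_of_pair
  (by simp [pair_counit_left]) (by
    rw [Comon.tensorObj_comul, pair_tensorHom_assoc, comp_comul, comp_comul, pair_pair_tensorμ w])

/-- `f` is an antihomomorphism of comonoids: it preserves the counit and reverses the
comultiplication. -/
class IsAnticomonHom [ComonObj X] (f : D ⟶ X) : Prop where
  hom_counit (f) : f ≫ ε[X] = ε[D]
  hom_comul (f) : f ≫ Δ[X] = pair f f ≫ (β_ X X).hom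

namespace IsAnticomonHom
attribute [simp] IsAnticomonHom.hom_counit
variable [ComonObj X] [ComonObj Y]

theorem comp_isComonHom (f : D ⟶ X) [IsAnticomonHom f] (g : X ⟶ Y) [IsComonHom g] :
    IsAnticomonHom (f ≫ g) where
  hom_counit := by simp
  hom_comul := by
    rw [Category.assoc, IsComonHom.hom_comul, ← Category.assoc, hom_comul, Category.assoc,
      ← BraidedCategory.braiding_naturality, pair_tensorHom_assoc]

theorem isComonHom_comp (f : D ⟶ X) [IsComonHom f] (g : X ⟶ Y) [IsAnticomonHom g] :
    IsAnticomonHom (f ≫ g) where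
  hom_counit := by simp
  hom_comul := by
    rw [Category.assoc, hom_comul, ← Category.assoc, comp_pair]

theorem pair {f : D ⟶ X} {g : D ⟶ Y} [IsAnticomonHom f] [IsAnticomonHom g]
    (w : Commutes f g) : IsAnticomonHom (pair f g) where
  hom_counit := by simp [pair_counit_left]
  hom_comul := by
    rw [Comon.tensorObj_comul, pair_tensorHom_assoc, hom_comul, hom_comul, ← pair_pair_tensorμ w,
      Category.assoc, SymmetricCategory.tensorμ_braid_swap, pair_tensorHom_assoc]

end IsAnticomonHom

end Symmetric

/-! ### Elementwise form of the axioms -/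

theorem IsHopfHom.isComonHom {C : Type u} [Category.{v} C] [MonoidalCategory C]
    {A A' : HopfData C} {f : A.X ⟶ A'.X} (h : IsHopfHom A A' f) : IsComonHom f where
  hom_counit := h.map_counit
  hom_comul := h.map_comul

section HopfElements

variable {C : Type u} [Category.{v} C] [MonoidalCategory C] [SymmetricCategory C]
variable {D X : C} [ComonObj D]

/-- The constant element with value the unit commutes with every element. -/
theorem Commutes.counit_one_left (A : HopfData C) (f : D ⟶ X) : Commutes (ε[D] ≫ A.one) f :=
  (Commutes.counit_left f).comp_left _

theorem HopfData.IsBialgebra.isComonHom_mul {A : HopfData C} (h : A.IsBialgebra) :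
    IsComonHom A.mul where
  hom_counit := by rw [h.mul_counit, Comon.tensorObj_counit]
  hom_comul := by rw [h.mul_comul, Comon.tensorObj_comul, Category.assoc]

variable (D) in
theorem HopfData.IsBialgebra.isComonHom_counit_one {A : HopfData C} (h : A.IsBialgebra) :
    IsComonHom (ε[D] ≫ A.one) := isComonHom_of_pair
  (by rw [Category.assoc, h.one_counit, Category.comp_id])
  (by rw [Category.assoc, h.one_comul, ← pair_tensorHom, pair_counit_left, Category.assoc])

theorem HopfData.IsAntihom.isAnticomonHom {A : HopfData C} {S : A.X ⟶ A.X} (h : A.IsAntihom S) :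
    IsAnticomonHom S where
  hom_counit := h.map_counit
  hom_comul := by
    rw [h.map_comul, pair, Category.assoc, BraidedCategory.braiding_naturality]

theorem HopfData.IsAntihom.pair_mul_comp {A : HopfData C} {S : A.X ⟶ A.X} (h : A.IsAntihom S)
    {f g : D ⟶ A.X} (w : Commutes f g) :
    (pair f g ≫ A.mul) ≫ S = pair (g ≫ S) (f ≫ S) ≫ A.mul := by
  rw [Category.assoc, h.map_mul, ← Category.assoc, w.eq, pair_tensorHom_assoc]

instance {A A' : HopfAlg C} (f : A ⟶ A') : IsComonHom f.hom := f.isHopfHom.isComonHom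

namespace HopfAlg

variable (A : HopfAlg C)

instance : IsComonHom A.mul := A.isHopf.isComonHom_mul

instance : IsComonHom (ε[D] ≫ A.one) := A.isHopf.isComonHom_counit_one D

instance : IsAnticomonHom A.SL := A.isHopf.antihom_SL.isAnticomonHom

@[simp]
theorem pair_one_mul (f : D ⟶ A.X) : pair (ε[D] ≫ A.one) f ≫ A.mul = f := by
  rw [← pair_whiskerRight, Category.assoc, A.isHopf.one_mul, pair_counit_leftUnitor]

@[simp]
theorem pair_mul_one (f : D ⟶ A.X) : pair f (ε[D] ≫ A.one) ≫ A.mul = f := by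
  rw [← pair_whiskerLeft, Category.assoc, A.isHopf.mul_one, pair_counit_rightUnitor]

theorem pair_SL_mul (f : D ⟶ A.X) [IsComonHom f] : pair (f ≫ A.SL) f ≫ A.mul = ε[D] ≫ A.one := by
  have h := f ≫= A.isHopf.antipode_left
  rwa [← Category.assoc, comp_comul, pair_whiskerRight_assoc, IsComonHom.hom_counit_assoc] at h

theorem pair_mul_SR (f : D ⟶ A.X) [IsComonHom f] : pair f (f ≫ A.SR) ≫ A.mul = ε[D] ≫ A.one := by
  have h := f ≫= A.isHopf.antipode_right
  rwa [← Category.assoc, comp_comul, pair_whiskerLeft_assoc, IsComonHom.hom_counit_assoc] at h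

variable {A} {A' : HopfAlg C}

theorem pair_mul_hom (p : A ⟶ A') (f g : D ⟶ A.X) :
    (pair f g ≫ A.mul) ≫ p.hom = pair (f ≫ p.hom) (g ≫ p.hom) ≫ A'.mul := by
  rw [Category.assoc, p.isHopfHom.map_mul, pair_tensorHom_assoc]

end HopfAlg

end HopfElements

namespace Act

variable {C : Type u} [Category.{v} C] [MonoidalCategory C] [SymmetricCategory C]
variable (T : Act C) {D : C} [ComonObj D] {b c : D ⟶ T.B.X} {x y : D ⟶ T.X.X}

instance : IsComonHom T.act := T.isAction.isComonHom

@[simp]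
theorem pair_one_act (x : D ⟶ T.X.X) : pair (ε[D] ≫ T.B.one) x ≫ T.act = x := by
  rw [← pair_whiskerRight, Category.assoc, T.isAction.one_act, pair_counit_leftUnitor]

theorem pair_act_one (hb : b ≫ ε[T.B.X] = ε[D]) :
    pair b (ε[D] ≫ T.X.one) ≫ T.act = ε[D] ≫ T.X.one := by
  rw [← pair_whiskerLeft, Category.assoc, T.isAction.act_one, pair_counit_rightUnitor_assoc,
    reassoc_of% hb]

theorem pair_mul_act (b c : D ⟶ T.B.X) (x : D ⟶ T.X.X) :
    pair (pair b c ≫ T.B.mul) x ≫ T.act = pair b (pair c x ≫ T.act) ≫ T.act := by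
  rw [← pair_whiskerRight, Category.assoc, T.isAction.mul_act, pair_associator_assoc,
    pair_whiskerLeft_assoc]

/-- The compatibility of the action with the braiding allows `theta` to be written as
`b ⊗ x ↦ (b₂ ▷ x) ⊗ b₁`. -/
theorem theta_eq_comul_braiding : T.theta = Δ[T.B.X] ▷ T.X.X ≫ (α_ T.B.X T.B.X T.X.X).hom ≫
    T.B.X ◁ T.act ≫ (β_ T.B.X T.X.X).hom := by
  have h := T.isAction.comul_act =≫ (β_ T.B.X T.X.X).hom
  simp only [Category.assoc] at h
  rw [h, BraidedCategory.braiding_naturality_right, BraidedCategory.braiding_tensor_right_hom]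
  simp only [Category.assoc, Iso.hom_inv_id_assoc, ← comp_whiskerRight_assoc,
    SymmetricCategory.symmetry, Category.comp_id]
  rfl

/-- `theta` does not change when the comultiplication of `B` in its definition is composed with the
braiding. -/
theorem comul_braiding_theta : T.theta = Δ[T.B.X] ▷ T.X.X ≫ (β_ T.B.X T.B.X).hom ▷ T.X.X ≫
    (α_ T.B.X T.B.X T.X.X).hom ≫ T.B.X ◁ (β_ T.B.X T.X.X).hom ≫
    (α_ T.B.X T.X.X T.B.X).inv ≫ T.act ▷ T.B.X := by
  rw [theta_eq_comul_braiding, BraidedCategory.braiding_naturality_right,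
    BraidedCategory.braiding_tensor_right_hom]
  simp

/-- The value of `theta` on a pair. An antihomomorphism of comonoids is as good as a homomorphism
here, because the action does not see the order of the comultiplication. -/
theorem pair_theta (hb : IsComonHom b ∨ IsAnticomonHom b) (w : Commutes b x) :
    pair b x ≫ T.theta = pair (pair b x ≫ T.act) b := by
  have h : pair (pair b b) x ≫ (α_ T.B.X T.B.X T.X.X).hom ≫ T.B.X ◁ (β_ T.B.X T.X.X).hom ≫
      (α_ T.B.X T.X.X T.B.X).inv ≫ T.act ▷ T.B.X = pair (pair b x ≫ T.act) b := by
    rw [pair_associator_assoc, pair_whiskerLeft_assoc, w.eq, pair_associator_inv_assoc,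
      pair_whiskerRight]
  rw [← h]
  obtain hb | hb := hb
  · rw [theta, pair_whiskerRight_assoc, comp_comul]
  · rw [comul_braiding_theta, pair_whiskerRight_assoc, pair_whiskerRight_assoc,
      IsAnticomonHom.hom_comul, Category.assoc, SymmetricCategory.symmetry, Category.comp_id]

/-- An element `b` commutes with `b ▷ x`: this is the elementwise form of the compatibility of the
action with the braiding. -/
theorem commutes_act (hb : IsComonHom b ∨ IsAnticomonHom b) (w : Commutes b x) :
    Commutes b (pair b x ≫ T.act) := by
  rw [Commutes, ← T.pair_theta hb w]
  obtain hb | hb := hb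
  · rw [theta_eq_comul_braiding, pair_whiskerRight_assoc, comp_comul, pair_associator_assoc,
      pair_whiskerLeft_assoc]
  · have h := T.isAction.comul_act =≫ (β_ T.B.X T.X.X).hom
    simp only [Category.assoc] at h
    rw [theta_eq_comul_braiding, h, pair_whiskerRight_assoc, pair_whiskerRight_assoc,
      IsAnticomonHom.hom_comul, Category.assoc, SymmetricCategory.symmetry, Category.comp_id,
      pair_associator_assoc, pair_whiskerLeft_assoc]

/-- The multiplicativity of the action, `b ▷ (x y) = (b₁ ▷ x) (b₂ ▷ y)`, written with `theta`. In
this form it can be evaluated by `pair_theta` also at antihomomorphisms `b`. -/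
theorem act_mul_eq_theta : T.B.X ◁ T.X.mul ≫ T.act = (α_ T.B.X T.X.X T.X.X).inv ≫
    T.theta ▷ T.X.X ≫ (α_ T.X.X T.B.X T.X.X).hom ≫ T.X.X ◁ T.act ≫ T.X.mul := by
  set b := projLeft T.B.X (T.X.X ⊗ T.X.X)
  set x := projRight T.B.X (T.X.X ⊗ T.X.X) ≫ projLeft T.X.X T.X.X
  set y := projRight T.B.X (T.X.X ⊗ T.X.X) ≫ projRight T.X.X T.X.X
  have h : pair b (pair x y) = 𝟙 _ := by
    rw [← comp_pair, pair_proj, Category.comp_id, pair_proj]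
  have w : Commutes b x := (Commutes.proj _ _).comp_right _
  rw [T.isAction.act_mul, ← Category.id_comp (_ ▷ _ ≫ _), ← Category.id_comp (Iso.inv _ ≫ _), ← h,
    pair_whiskerRight_assoc, comp_comul, pair_pair_tensorμ_assoc w, pair_tensorHom_assoc,
    pair_associator_inv_assoc, pair_whiskerRight_assoc, T.pair_theta (.inl inferInstance) w,
    pair_associator_assoc, pair_whiskerLeft_assoc]

theorem pair_act_mul (hb : IsComonHom b ∨ IsAnticomonHom b) (w : Commutes b x) (y : D ⟶ T.X.X) :
    pair b (pair x y ≫ T.X.mul) ≫ T.act =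
      pair (pair b x ≫ T.act) (pair b y ≫ T.act) ≫ T.X.mul := by
  rw [← pair_whiskerLeft, Category.assoc, act_mul_eq_theta, pair_associator_inv_assoc,
    pair_whiskerRight_assoc, T.pair_theta hb w, pair_associator_assoc, pair_whiskerLeft_assoc]

/-- The multiplication of the semidirect product, with the underlying object displayed as a tensor
product: `(x ⊗ b) ⊗ (y ⊗ c) ↦ x (b₁ ▷ y) ⊗ b₂ c`. -/
def semidirectMul : (T.X.X ⊗ T.B.X) ⊗ (T.X.X ⊗ T.B.X) ⟶ T.X.X ⊗ T.B.X :=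
  (α_ T.X.X T.B.X (T.X.X ⊗ T.B.X)).hom ≫
    T.X.X ◁ ((α_ T.B.X T.X.X T.B.X).inv ≫ T.theta ▷ T.B.X ≫ (α_ T.X.X T.B.X T.B.X).hom) ≫
    (α_ T.X.X T.X.X (T.B.X ⊗ T.B.X)).inv ≫ (T.X.mul ⊗ₘ T.B.mul)

theorem pair_semidirectMul (hb : IsComonHom b ∨ IsAnticomonHom b) (w : Commutes b y)
    (x : D ⟶ T.X.X) (c : D ⟶ T.B.X) :
    pair (pair x b) (pair y c) ≫ T.semidirectMul =
      pair (pair x (pair b y ≫ T.act) ≫ T.X.mul) (pair b c ≫ T.B.mul) := by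
  rw [semidirectMul, pair_associator_assoc, pair_whiskerLeft_assoc, pair_associator_inv_assoc,
    pair_whiskerRight_assoc, T.pair_theta hb w, pair_associator, pair_associator_inv_assoc,
    pair_tensorHom]

end Act

/-! ### The semidirect product is a Hopf algebra -/

namespace Act

variable {C : Type u} [Category.{v} C] [MonoidalCategory C] [SymmetricCategory C]
variable (T : Act C) {D : C} [ComonObj D]

section Elements

variable {x y : D ⟶ T.X.X} {b c : D ⟶ T.B.X} [IsComonHom b]

/-- The two entries of the product `x (b₁ ▷ y) ⊗ b₂ c` commute. -/
theorem commutes_mul_factors (hxb : Commutes x b) (hxc : Commutes x c) (hby : Commutes b y)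
    (hbc : Commutes b c) (hyc : Commutes y c) :
    Commutes (pair x (pair b y ≫ T.act) ≫ T.X.mul) (pair b c ≫ T.B.mul) :=
  ((hxb.pair_right hxc).pair_left ((T.commutes_act (.inl inferInstance) hby).symm.pair_right
    ((hbc.pair_left hyc).comp_left _))).comp _ _

theorem isComonHom_mul_left [IsComonHom x] [IsComonHom y] (hxb : Commutes x b)
    (hxy : Commutes x y) (hby : Commutes b y) :
    IsComonHom (pair x (pair b y ≫ T.act) ≫ T.X.mul) := by
  have := isComonHom_pair hby
  have := isComonHom_pair ((hxb.pair_right hxy).comp_right T.act)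
  infer_instance

end Elements

theorem isComonHom_semidirectMul : IsComonHom T.semidirectMul := by
  have key : ∀ (D : C) [ComonObj D] (x : D ⟶ T.X.X) (b : D ⟶ T.B.X) (y : D ⟶ T.X.X)
      (c : D ⟶ T.B.X) [IsComonHom x] [IsComonHom b] [IsComonHom y] [IsComonHom c],
      Commutes x b → Commutes x y → Commutes x c → Commutes b y → Commutes b c → Commutes y c →
      IsComonHom (pair (pair x b) (pair y c) ≫ T.semidirectMul) := by
    intro D _ x b y c _ _ _ _ hxb hxy hxc hby hbc hyc
    have := T.isComonHom_mul_left hxb hxy hby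
    have := isComonHom_pair hbc
    rw [T.pair_semidirectMul (.inl inferInstance) hby]
    exact isComonHom_pair (T.commutes_mul_factors hxb hxc hby hbc hyc)
  have counit : T.semidirectMul ≫ ε = ε := hom_ext_pair_pair
    fun D _ x b y c _ _ _ _ hxb hxy hxc hby hbc hyc => by
      have := key D x b y c hxb hxy hxc hby hbc hyc
      have := isComonHom_pair hxb
      have := isComonHom_pair hyc
      have := isComonHom_pair ((hxy.pair_right hxc).pair_left (hby.pair_right hbc))
      rw [← Category.assoc, IsComonHom.hom_counit, IsComonHom.hom_counit]
  refine isComonHom_of_pair counit (hom_ext_pair_pair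
    fun D _ x b y c _ _ _ _ hxb hxy hxc hby hbc hyc => ?_)
  have := key D x b y c hxb hxy hxc hby hbc hyc
  have := isComonHom_pair hxb
  have := isComonHom_pair hyc
  have := isComonHom_pair ((hxy.pair_right hxc).pair_left (hby.pair_right hbc))
  rw [← Category.assoc, comp_comul, comp_pair]

/-- The unit of the semidirect product. -/
def semidirectOne : 𝟙_ C ⟶ T.X.X ⊗ T.B.X := (λ_ (𝟙_ C)).inv ≫ (T.X.one ⊗ₘ T.B.one)

theorem counit_semidirectOne :
    ε[D] ≫ T.semidirectOne = pair (ε[D] ≫ T.X.one) (ε[D] ≫ T.B.one) := by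
  rw [semidirectOne, ← pair_tensorHom, pair_counit_left, Category.assoc]

theorem isBialgebra_semidirect : T.semidirect.IsBialgebra := by
  have h := T.isComonHom_semidirectMul
  have hone : T.semidirectOne ≫ Δ = (λ_ (𝟙_ C)).inv ≫ (T.semidirectOne ⊗ₘ T.semidirectOne) ∧
      T.semidirectOne ≫ ε = 𝟙 (𝟙_ C) := by
    -- The unit is a generalized element over the trivial comonoid, whose counit is the identity.
    let _ := ComonObj.instTensorUnit C
    have h1 : IsComonHom (ε[𝟙_ C] ≫ T.semidirectOne) := by
      rw [counit_semidirectOne]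
      exact isComonHom_pair (Commutes.counit_one_left _ _)
    have h2 : ε[𝟙_ C] ≫ T.semidirectOne = T.semidirectOne := Category.id_comp _
    rw [h2] at h1
    exact ⟨h1.hom_comul, h1.hom_counit⟩
  refine
  { one_mul := ?_
    mul_one := ?_
    mul_comul := h.hom_comul.trans ?_
    one_comul := hone.1
    mul_counit := h.hom_counit
    one_counit := hone.2 }
  · change T.semidirectOne ▷ (T.X.X ⊗ T.B.X) ≫ T.semidirectMul = (λ_ (T.X.X ⊗ T.B.X)).hom
    rw [← cancel_epi (λ_ (T.X.X ⊗ T.B.X)).inv, Iso.inv_hom_id,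
      ← Category.id_comp (λ_ (T.X.X ⊗ T.B.X)).inv, ← pair_counit_left,
      pair_whiskerRight_assoc, counit_semidirectOne, ← pair_proj,
      T.pair_semidirectMul (.inl inferInstance) (Commutes.counit_one_left _ _), pair_one_act,
      HopfAlg.pair_one_mul, HopfAlg.pair_one_mul]
  · change (T.X.X ⊗ T.B.X) ◁ T.semidirectOne ≫ T.semidirectMul = (ρ_ (T.X.X ⊗ T.B.X)).hom
    rw [← cancel_epi (ρ_ (T.X.X ⊗ T.B.X)).inv, Iso.inv_hom_id,
      ← Category.id_comp (ρ_ (T.X.X ⊗ T.B.X)).inv, ← pair_counit_right,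
      pair_whiskerLeft_assoc, counit_semidirectOne, ← pair_proj,
      T.pair_semidirectMul (.inl inferInstance) (Commutes.counit_one_left _ _).symm,
      pair_act_one _ (IsComonHom.hom_counit _), HopfAlg.pair_mul_one, HopfAlg.pair_mul_one]
  · rw [Comon.tensorObj_comul, Category.assoc]; rfl

section Antipode

/-- The morphism `x ⊗ b ↦ Θ (sB b ⊗ sX x)`, the form of both antipodes of the semidirect product. -/
def semidirectAntipode (sB : T.B.X ⟶ T.B.X) (sX : T.X.X ⟶ T.X.X) :
    T.X.X ⊗ T.B.X ⟶ T.X.X ⊗ T.B.X :=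
  (β_ T.X.X T.B.X).hom ≫ (sB ⊗ₘ sX) ≫ T.theta

variable {sB : T.B.X ⟶ T.B.X} {sX : T.X.X ⟶ T.X.X}
variable {x : D ⟶ T.X.X} {b : D ⟶ T.B.X}

theorem pair_semidirectAntipode [IsAnticomonHom sB] [IsComonHom b] (w : Commutes x b) :
    pair x b ≫ T.semidirectAntipode sB sX =
      pair (pair (b ≫ sB) (x ≫ sX) ≫ T.act) (b ≫ sB) := by
  rw [semidirectAntipode, ← Category.assoc, w.eq, pair_tensorHom_assoc,
    T.pair_theta (.inr (.isComonHom_comp _ _)) (w.symm.comp _ _)]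

/-- The compatibility of an action with a pair of antipodes `sB` and `sX`; in Sweedler notation,
`sB b₁ ▷ sX (b₂ ▷ x) = ε b (sX x)`. -/
def AntipodeCompatible (sB : T.B.X ⟶ T.B.X) (sX : T.X.X ⟶ T.X.X) : Prop :=
  Δ[T.B.X] ▷ T.X.X ≫ (α_ T.B.X T.B.X T.X.X).hom ≫ T.B.X ◁ T.act ≫ (sB ⊗ₘ sX) ≫ T.act =
    ε[T.B.X] ▷ T.X.X ≫ (λ_ T.X.X).hom ≫ sX

variable {T}

theorem AntipodeCompatible.pair_act (h : T.AntipodeCompatible sB sX) (b : D ⟶ T.B.X)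
    [IsComonHom b] (x : D ⟶ T.X.X) :
    pair (b ≫ sB) ((pair b x ≫ T.act) ≫ sX) ≫ T.act = x ≫ sX := by
  have h' := pair b x ≫= h
  rwa [pair_whiskerRight_assoc, comp_comul, pair_associator_assoc, pair_whiskerLeft_assoc,
    pair_tensorHom_assoc, pair_whiskerRight_assoc, IsComonHom.hom_counit,
    pair_counit_leftUnitor_assoc] at h'

variable (T)

theorem antipodeCompatible_SR : T.AntipodeCompatible T.B.SR T.X.SR := T.isAction.act_SR

/-- For the left antipode the compatibility holds because `S b₁ ▷ S(b₂ ▷ x) = (S b₁) b₂ ▷ S x`. -/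
theorem antipodeCompatible_SL : T.AntipodeCompatible T.B.SL T.X.SL :=
  hom_ext_pair fun D _ b x _ _ _ => by
    rw [pair_whiskerRight_assoc, comp_comul, pair_associator_assoc, pair_whiskerLeft_assoc,
      pair_tensorHom_assoc, pair_whiskerRight_assoc, IsComonHom.hom_counit,
      pair_counit_leftUnitor_assoc, Category.assoc, ← T.isAction.act_SL, pair_whiskerLeft_assoc,
      ← pair_mul_act, T.B.pair_SL_mul, pair_one_act]

variable {T}

/-- Compatible antihomomorphisms of `B` and of `X` induce an antihomomorphism of the semidirect
product. -/
theorem AntipodeCompatible.isAntihom (h : T.AntipodeCompatible sB sX) (hB : T.B.IsAntihom sB)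
    (hX : T.X.IsAntihom sX) : T.semidirect.IsAntihom (T.semidirectAntipode sB sX) := by
  have := hB.isAnticomonHom
  have := hX.isAnticomonHom
  have key : IsAnticomonHom (T.semidirectAntipode sB sX) := by
    have hs := T.pair_semidirectAntipode (sB := sB) (sX := sX) (Commutes.proj T.X.X T.B.X)
    rw [pair_proj, Category.id_comp] at hs
    rw [hs]
    have w := (Commutes.proj T.X.X T.B.X).symm.comp sB sX
    have := IsAnticomonHom.isComonHom_comp (projRight T.X.X T.B.X) sB
    have := IsAnticomonHom.isComonHom_comp (projLeft T.X.X T.B.X) sX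
    have := IsAnticomonHom.pair w
    have := IsAnticomonHom.comp_isComonHom
      (pair (projRight T.X.X T.B.X ≫ sB) (projLeft T.X.X T.B.X ≫ sX)) T.act
    exact IsAnticomonHom.pair (T.commutes_act (.inr inferInstance) w).symm
  refine
  { map_mul := ?_
    map_one := ?_
    map_comul := by
      refine key.hom_comul.trans ?_
      rw [pair, Category.assoc, BraidedCategory.braiding_naturality]; rfl
    map_counit := key.hom_counit }
  · refine hom_ext_pair_pair (p := T.semidirectMul ≫ T.semidirectAntipode sB sX)
      (q := (β_ _ _).hom ≫ (T.semidirectAntipode sB sX ⊗ₘ T.semidirectAntipode sB sX) ≫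
        T.semidirectMul)
      fun D _ x b y c _ _ _ _ hxb hxy hxc hby hbc hyc => ?_
    have := IsAnticomonHom.isComonHom_comp b sB
    have := IsAnticomonHom.isComonHom_comp c sB
    have := isComonHom_pair hbc
    have w := T.commutes_mul_factors hxb hxc hby hbc hyc
    have w' : Commutes (pair x b) (pair y c) := (hxy.pair_right hxc).pair_left (hby.pair_right hbc)
    -- With `β = S b`, `γ = S c`, `ξ = S x`, both sides are
    -- `(γ ▷ S y) (γ ▷ (β ▷ ξ)) ⊗ γ β`; on the left-hand side `S y` arises as `β ▷ S(b ▷ y)`.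
    rw [← Category.assoc, T.pair_semidirectMul (.inl inferInstance) hby,
      T.pair_semidirectAntipode w, hB.pair_mul_comp hbc,
      hX.pair_mul_comp ((hxb.pair_right hxy).comp_right _), pair_mul_act,
      T.pair_act_mul (.inr inferInstance) ((T.commutes_act (.inl inferInstance) hby).comp _ _),
      h.pair_act, T.pair_act_mul (.inr inferInstance) (hyc.symm.comp _ _), ← Category.assoc, w'.eq,
      pair_tensorHom_assoc, T.pair_semidirectAntipode hyc, T.pair_semidirectAntipode hxb,
      T.pair_semidirectMul (.inr inferInstance)]
    exact ((hbc.symm.comp _ _).pair_right (hxc.symm.comp _ _)).comp_right _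
  · let _ := ComonObj.instTensorUnit C
    change T.semidirectOne ≫ _ = T.semidirectOne
    have h1 : (ε[𝟙_ C] ≫ T.B.one) ≫ sB = ε[𝟙_ C] ≫ T.B.one := by rw [Category.assoc, hB.map_one]
    rw [← Category.id_comp T.semidirectOne, ← ComonObj.instTensorUnit_counit,
      counit_semidirectOne, T.pair_semidirectAntipode (Commutes.counit_one_left _ _),
      h1, pair_one_act, Category.assoc, hX.map_one]

end Antipode

/-- The compatibility of `theta` with the multiplication of `B`: half of a distributive law. -/
theorem mul_theta : T.B.mul ▷ T.X.X ≫ T.theta = (α_ _ _ _).hom ≫ T.B.X ◁ T.theta ≫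
    (α_ _ _ _).inv ≫ T.theta ▷ T.B.X ≫ (α_ _ _ _).hom ≫ T.X.X ◁ T.B.mul :=
  hom_ext_pair_pair_left fun D _ b c x _ _ _ hbc hbx hcx => by
    have := isComonHom_pair hbc
    rw [pair_whiskerRight_assoc,
      T.pair_theta (.inl inferInstance) ((hbx.pair_left hcx).comp_left _),
      pair_associator_assoc, pair_whiskerLeft_assoc, T.pair_theta (.inl inferInstance) hcx,
      pair_associator_inv_assoc, pair_whiskerRight_assoc,
      T.pair_theta (.inl inferInstance) ((hbc.pair_right hbx).comp_right _),
      pair_associator_assoc, pair_whiskerLeft, pair_mul_act]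

/-- The product `(x ⊗ b) Θ(c ⊗ ξ) = (x ⊗ 1) Θ(b c ⊗ ξ)`. No entries have to commute, so that this
applies to `c = S b`, which need not commute with `b`. -/
theorem pair_theta_semidirectMul (x ξ : D ⟶ T.X.X) (b c : D ⟶ T.B.X) :
    pair (pair x b) (pair c ξ ≫ T.theta) ≫ T.semidirectMul =
      pair x (pair (pair b c ≫ T.B.mul) ξ ≫ T.theta) ≫ (α_ _ _ _).inv ≫ T.X.mul ▷ T.B.X := by
  rw [semidirectMul, pair_associator_assoc, pair_whiskerLeft_assoc, ← pair_whiskerRight,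
    Category.assoc, T.mul_theta]
  simp [MonoidalCategory.tensorHom_def']

theorem isHopf_semidirect : T.semidirect.IsHopf where
  toIsBialgebra := T.isBialgebra_semidirect
  antihom_SL := T.antipodeCompatible_SL.isAntihom T.B.isHopf.antihom_SL T.X.isHopf.antihom_SL
  antihom_SR := T.antipodeCompatible_SR.isAntihom T.B.isHopf.antihom_SR T.X.isHopf.antihom_SR
  antipode_left := by
    set x := projLeft T.X.X T.B.X
    set b := projRight T.X.X T.B.X
    have w : Commutes x b := Commutes.proj T.X.X T.B.X
    change Δ[T.X.X ⊗ T.B.X] ≫ T.semidirectAntipode T.B.SL T.X.SL ▷ (T.X.X ⊗ T.B.X) ≫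
      T.semidirectMul = ε[T.X.X ⊗ T.B.X] ≫ T.semidirectOne
    have := IsAnticomonHom.isComonHom_comp b T.B.SL
    rw [comul_eq_pair, pair_whiskerRight_assoc, ← pair_proj, T.pair_semidirectAntipode w,
      T.pair_semidirectMul (.inr inferInstance) (w.symm.comp_left _),
      ← T.pair_act_mul (.inr inferInstance) (w.symm.comp _ _), T.X.pair_SL_mul, T.B.pair_SL_mul,
      T.pair_act_one (IsAnticomonHom.hom_counit _), counit_semidirectOne]
  antipode_right := by
    set x := projLeft T.X.X T.B.X
    set b := projRight T.X.X T.B.X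
    have w : Commutes x b := Commutes.proj T.X.X T.B.X
    change Δ[T.X.X ⊗ T.B.X] ≫ (T.X.X ⊗ T.B.X) ◁ T.semidirectAntipode T.B.SR T.X.SR ≫
      T.semidirectMul = ε[T.X.X ⊗ T.B.X] ≫ T.semidirectOne
    rw [comul_eq_pair, pair_whiskerLeft_assoc, ← pair_proj, semidirectAntipode,
      ← Category.assoc (pair _ _), w.eq, pair_tensorHom_assoc, pair_theta_semidirectMul,
      T.B.pair_mul_SR, T.pair_theta (.inl inferInstance) (Commutes.counit_one_left _ _),
      pair_one_act, pair_associator_inv_assoc, pair_whiskerRight, T.X.pair_mul_SR,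
      counit_semidirectOne]

end Act

/-! ### The split extension of an action -/

namespace Act

variable {C : Type u} [Category.{v} C] [MonoidalCategory C] [SymmetricCategory C]
variable (T : Act C) {D : C} [ComonObj D]

/-- The inclusion of `X` into the semidirect product. -/
def semidirectInl : T.X.X ⟶ T.X.X ⊗ T.B.X := (ρ_ T.X.X).inv ≫ T.X.X ◁ T.B.one

/-- The inclusion of `B` into the semidirect product. -/
def semidirectInr : T.B.X ⟶ T.X.X ⊗ T.B.X := (λ_ T.B.X).inv ≫ T.X.one ▷ T.B.X

theorem comp_semidirectInl (x : D ⟶ T.X.X) :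
    x ≫ T.semidirectInl = pair x (ε[D] ≫ T.B.one) := by
  rw [semidirectInl, ← Category.assoc, ← pair_counit_right, pair_whiskerLeft]

theorem comp_semidirectInr (b : D ⟶ T.B.X) :
    b ≫ T.semidirectInr = pair (ε[D] ≫ T.X.one) b := by
  rw [semidirectInr, ← Category.assoc, ← pair_counit_left, pair_whiskerRight]

theorem isComonHom_semidirectInl : IsComonHom T.semidirectInl := by
  rw [← Category.id_comp T.semidirectInl, comp_semidirectInl]
  exact isComonHom_pair (Commutes.counit_one_left _ _).symm

theorem isComonHom_semidirectInr : IsComonHom T.semidirectInr := by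
  rw [← Category.id_comp T.semidirectInr, comp_semidirectInr]
  exact isComonHom_pair (Commutes.counit_one_left _ _)

section

variable {T} {sB : T.B.X ⟶ T.B.X} {sX : T.X.X ⟶ T.X.X}

theorem comp_semidirectInl_antipode (hB : T.B.IsAntihom sB) :
    T.semidirectInl ≫ T.semidirectAntipode sB sX = sX ≫ T.semidirectInl := by
  have := hB.isAnticomonHom
  rw [comp_semidirectInl, ← Category.id_comp T.semidirectInl, comp_semidirectInl,
    T.pair_semidirectAntipode (Commutes.counit_one_left _ _).symm, Category.id_comp,
    Category.assoc, hB.map_one, pair_one_act]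

theorem comp_semidirectInr_antipode (hB : T.B.IsAntihom sB) (hX : T.X.IsAntihom sX) :
    T.semidirectInr ≫ T.semidirectAntipode sB sX = sB ≫ T.semidirectInr := by
  have := hB.isAnticomonHom
  rw [comp_semidirectInr, ← Category.id_comp T.semidirectInr, comp_semidirectInr,
    T.pair_semidirectAntipode (Commutes.counit_one_left _ _), Category.id_comp,
    Category.assoc, hX.map_one,
    T.pair_act_one (IsAnticomonHom.hom_counit _)]

theorem semidirectAntipode_comp_projRight (hB : T.B.IsAntihom sB) (hX : T.X.IsAntihom sX) :
    T.semidirectAntipode sB sX ≫ projRight T.X.X T.B.X = projRight T.X.X T.B.X ≫ sB := by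
  have := hB.isAnticomonHom
  have := hX.isAnticomonHom
  rw [← Category.id_comp (T.semidirectAntipode sB sX), ← pair_proj,
    T.pair_semidirectAntipode (Commutes.proj _ _), pair_projRight_of_counit]
  rw [Category.assoc, IsComonHom.hom_counit, Comon.tensorObj_counit, pair_tensorHom_assoc,
    Category.assoc, Category.assoc, IsAnticomonHom.hom_counit sB, IsAnticomonHom.hom_counit sX,
    IsComonHom.hom_counit, IsComonHom.hom_counit, pair_counit_leftUnitor]

end

theorem isHopfHom_inl : IsHopfHom T.X.toHopfData T.semidirect T.inl where
  map_mul := by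
    change T.X.mul ≫ T.semidirectInl = (T.semidirectInl ⊗ₘ T.semidirectInl) ≫ T.semidirectMul
    refine hom_ext_pair fun D _ x y _ _ w => ?_
    rw [pair_tensorHom_assoc, comp_semidirectInl T x, comp_semidirectInl T y,
      T.pair_semidirectMul (.inl inferInstance) (Commutes.counit_one_left _ _), pair_one_act,
      HopfAlg.pair_mul_one, ← Category.assoc, comp_semidirectInl]
  map_one := by
    change T.X.one ≫ T.semidirectInl = T.semidirectOne
    let _ := ComonObj.instTensorUnit C
    rw [comp_semidirectInl, ← Category.id_comp T.semidirectOne, ← ComonObj.instTensorUnit_counit,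
      counit_semidirectOne]
    simp
  map_comul := T.isComonHom_semidirectInl.hom_comul
  map_counit := T.isComonHom_semidirectInl.hom_counit
  map_SL := (comp_semidirectInl_antipode T.B.isHopf.antihom_SL).symm
  map_SR := (comp_semidirectInl_antipode T.B.isHopf.antihom_SR).symm

theorem isHopfHom_inr : IsHopfHom T.B.toHopfData T.semidirect T.inr where
  map_mul := by
    change T.B.mul ≫ T.semidirectInr = (T.semidirectInr ⊗ₘ T.semidirectInr) ≫ T.semidirectMul
    refine hom_ext_pair fun D _ b c _ _ w => ?_
    rw [pair_tensorHom_assoc, comp_semidirectInr T b, comp_semidirectInr T c,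
      T.pair_semidirectMul (.inl inferInstance) (Commutes.counit_one_left _ _).symm,
      T.pair_act_one (IsComonHom.hom_counit _),
      HopfAlg.pair_mul_one, ← Category.assoc, comp_semidirectInr]
  map_one := by
    change T.B.one ≫ T.semidirectInr = T.semidirectOne
    let _ := ComonObj.instTensorUnit C
    rw [comp_semidirectInr, ← Category.id_comp T.semidirectOne, ← ComonObj.instTensorUnit_counit,
      counit_semidirectOne]
    simp
  map_comul := T.isComonHom_semidirectInr.hom_comul
  map_counit := T.isComonHom_semidirectInr.hom_counit
  map_SL := (comp_semidirectInr_antipode T.B.isHopf.antihom_SL T.X.isHopf.antihom_SL).symm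
  map_SR := (comp_semidirectInr_antipode T.B.isHopf.antihom_SR T.X.isHopf.antihom_SR).symm

theorem isHopfHom_snd : IsHopfHom T.semidirect T.B.toHopfData T.snd where
  map_mul := by
    change T.semidirectMul ≫ projRight _ _ = (projRight _ _ ⊗ₘ projRight _ _) ≫ T.B.mul
    refine hom_ext_pair_pair fun D _ x b y c _ _ _ _ hxb hxy hxc hby hbc hyc => ?_
    have := T.isComonHom_mul_left hxb hxy hby
    rw [← Category.assoc, T.pair_semidirectMul (.inl inferInstance) hby, pair_projRight,
      pair_tensorHom_assoc, pair_projRight, pair_projRight]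
  map_one := by
    change T.semidirectOne ≫ projRight _ _ = T.B.one
    let _ := ComonObj.instTensorUnit C
    rw [← Category.id_comp T.semidirectOne, ← ComonObj.instTensorUnit_counit,
      counit_semidirectOne, pair_projRight]
    simp
  map_comul := IsComonHom.hom_comul (projRight T.X.X T.B.X)
  map_counit := IsComonHom.hom_counit (projRight T.X.X T.B.X)
  map_SL := semidirectAntipode_comp_projRight T.B.isHopf.antihom_SL T.X.isHopf.antihom_SL
  map_SR := semidirectAntipode_comp_projRight T.B.isHopf.antihom_SR T.X.isHopf.antihom_SR

/-- The failure of associativity of the semidirect product is controlled by that of `X` and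
of `B`: three elements `x ⊗ b`, `y ⊗ c`, `z ⊗ d` associate as soon as `x`, `b ▷ y`, `b ▷ (c ▷ z)`
associate in `X` and `b`, `c`, `d` associate in `B`. -/
theorem semidirectMul_assoc {x y z : D ⟶ T.X.X} {b c d : D ⟶ T.B.X} [IsComonHom b] [IsComonHom c]
    (hby : Commutes b y) (hbc : Commutes b c) (hbz : Commutes b z) (hcz : Commutes c z)
    (hX : pair (pair x (pair b y ≫ T.act) ≫ T.X.mul) (pair b (pair c z ≫ T.act) ≫ T.act) ≫
        T.X.mul =
      pair x (pair (pair b y ≫ T.act) (pair b (pair c z ≫ T.act) ≫ T.act) ≫ T.X.mul) ≫ T.X.mul)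
    (hB : pair (pair b c ≫ T.B.mul) d ≫ T.B.mul = pair b (pair c d ≫ T.B.mul) ≫ T.B.mul) :
    pair (pair (pair x b) (pair y c) ≫ T.semidirectMul) (pair z d) ≫ T.semidirectMul =
      pair (pair x b) (pair (pair y c) (pair z d) ≫ T.semidirectMul) ≫ T.semidirectMul := by
  have := isComonHom_pair hbc
  rw [T.pair_semidirectMul (.inl inferInstance) hby, T.pair_semidirectMul (.inl inferInstance) hcz,
    T.pair_semidirectMul (.inl inferInstance) ((hbz.pair_left hcz).comp_left _),
    T.pair_semidirectMul (.inl inferInstance)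
      ((hby.pair_right ((hbc.pair_right hbz).comp_right _)).comp_right _),
    pair_mul_act, hX, hB, T.pair_act_mul (.inl inferInstance) hby]

theorem semidirect_assoc_inl_inr_id :
    ((T.semidirectInl ⊗ₘ T.semidirectInr) ⊗ₘ 𝟙 (T.X.X ⊗ T.B.X)) ≫
        T.semidirectMul ▷ (T.X.X ⊗ T.B.X) ≫ T.semidirectMul =
      ((T.semidirectInl ⊗ₘ T.semidirectInr) ⊗ₘ 𝟙 (T.X.X ⊗ T.B.X)) ≫
        (α_ _ _ _).hom ≫ (T.X.X ⊗ T.B.X) ◁ T.semidirectMul ≫ T.semidirectMul :=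
  hom_ext_pair_pair fun D _ x b y c _ _ _ _ hxb hxy hxc hby hbc hyc => by
    simp only [pair_tensorHom_assoc, pair_whiskerRight_assoc, pair_associator_assoc,
      pair_whiskerLeft_assoc, comp_semidirectInl, comp_semidirectInr, Category.comp_id,
      pair_tensorHom]
    apply T.semidirectMul_assoc
    · exact Commutes.counit_one_left _ _
    · exact Commutes.counit_one_left _ _
    · exact Commutes.counit_one_left _ _
    · exact hby
    · simp
    · simp

theorem semidirect_assoc_inl_id_inr :
    ((T.semidirectInl ⊗ₘ 𝟙 (T.X.X ⊗ T.B.X)) ⊗ₘ T.semidirectInr) ≫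
        T.semidirectMul ▷ (T.X.X ⊗ T.B.X) ≫ T.semidirectMul =
      ((T.semidirectInl ⊗ₘ 𝟙 (T.X.X ⊗ T.B.X)) ⊗ₘ T.semidirectInr) ≫
        (α_ _ _ _).hom ≫ (T.X.X ⊗ T.B.X) ◁ T.semidirectMul ≫ T.semidirectMul :=
  hom_ext_pair_pair_left fun D _ x h c _ _ _ hxh hxc hhc => by
    obtain ⟨y, b, hy, hb, w, rfl⟩ := exists_eq_pair h
    simp only [pair_tensorHom_assoc, pair_whiskerRight_assoc, pair_associator_assoc,
      pair_whiskerLeft_assoc, comp_semidirectInl, comp_semidirectInr, Category.comp_id,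
      pair_tensorHom]
    apply T.semidirectMul_assoc
    · exact Commutes.counit_one_left _ _
    · exact Commutes.counit_one_left _ _
    · exact Commutes.counit_one_left _ _
    · exact (Commutes.counit_one_left _ _).symm
    · simp [T.pair_act_one (IsComonHom.hom_counit _)]
    · simp

theorem semidirect_assoc_id_inl_inr :
    ((𝟙 (T.X.X ⊗ T.B.X) ⊗ₘ T.semidirectInl) ⊗ₘ T.semidirectInr) ≫
        T.semidirectMul ▷ (T.X.X ⊗ T.B.X) ≫ T.semidirectMul =
      ((𝟙 (T.X.X ⊗ T.B.X) ⊗ₘ T.semidirectInl) ⊗ₘ T.semidirectInr) ≫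
        (α_ _ _ _).hom ≫ (T.X.X ⊗ T.B.X) ◁ T.semidirectMul ≫ T.semidirectMul :=
  hom_ext_pair_pair_left fun D _ h y c _ _ _ hhy hhc hyc => by
    obtain ⟨x, b, hx, hb, w, rfl⟩ := exists_eq_pair h
    simp only [pair_tensorHom_assoc, pair_whiskerRight_assoc, pair_associator_assoc,
      pair_whiskerLeft_assoc, comp_semidirectInl, comp_semidirectInr, Category.comp_id,
      pair_tensorHom]
    apply T.semidirectMul_assoc
    · simpa using hhy.comp_left (projRight _ _)
    · exact (Commutes.counit_one_left _ _).symm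
    · exact (Commutes.counit_one_left _ _).symm
    · exact Commutes.counit_one_left _ _
    · simp [T.pair_act_one (IsComonHom.hom_counit _)]
    · simp

theorem semidirect_assoc_inr_id_inl :
    ((T.semidirectInr ⊗ₘ 𝟙 (T.X.X ⊗ T.B.X)) ⊗ₘ T.semidirectInl) ≫
        T.semidirectMul ▷ (T.X.X ⊗ T.B.X) ≫ T.semidirectMul =
      ((T.semidirectInr ⊗ₘ 𝟙 (T.X.X ⊗ T.B.X)) ⊗ₘ T.semidirectInl) ≫
        (α_ _ _ _).hom ≫ (T.X.X ⊗ T.B.X) ◁ T.semidirectMul ≫ T.semidirectMul :=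
  hom_ext_pair_pair_left fun D _ b h z _ _ _ hbh hbz hhz => by
    obtain ⟨y, c, hy, hc, w, rfl⟩ := exists_eq_pair h
    simp only [pair_tensorHom_assoc, pair_whiskerRight_assoc, pair_associator_assoc,
      pair_whiskerLeft_assoc, comp_semidirectInl, comp_semidirectInr, Category.comp_id,
      pair_tensorHom]
    apply T.semidirectMul_assoc
    · simpa using hbh.comp_right (projLeft _ _)
    · simpa using hbh.comp_right (projRight _ _)
    · exact hbz
    · simpa using hhz.comp_left (projRight _ _)
    · simp
    · simp

/-- The semidirect product Hopf algebra. -/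
abbrev semidirectHopf : HopfAlg C := ⟨T.semidirect, T.isHopf_semidirect⟩

/-- The inclusion of `X`, as a morphism of Hopf algebras. -/
def inlHom : T.X ⟶ T.semidirectHopf := ⟨T.inl, T.isHopfHom_inl⟩

/-- The inclusion of `B`, as a morphism of Hopf algebras. -/
def inrHom : T.B ⟶ T.semidirectHopf := ⟨T.inr, T.isHopfHom_inr⟩

/-- The projection to `B`, as a morphism of Hopf algebras. -/
def sndHom : T.semidirectHopf ⟶ T.B := ⟨T.snd, T.isHopfHom_snd⟩

/-- The semidirect product recovers the action. -/
theorem extAct_semidirect : extAct T.inlHom T.inrHom T.fst = T.act := by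
  change (T.semidirectInr ⊗ₘ T.semidirectInl) ≫ T.semidirectMul ≫ projLeft _ _ = T.act
  refine hom_ext_pair fun D _ b x _ _ w => ?_
  rw [pair_tensorHom_assoc, comp_semidirectInl, comp_semidirectInr, ← Category.assoc,
    T.pair_semidirectMul (.inl inferInstance) w, HopfAlg.pair_mul_one, HopfAlg.pair_one_mul,
    pair_projLeft]

theorem isSplitExt_semidirect : IsSplitExt T.inlHom T.sndHom T.inrHom T.fst where
  κ_lam := by
    change T.semidirectInl ≫ projLeft _ _ = 𝟙 _
    rw [← Category.id_comp T.semidirectInl, comp_semidirectInl, pair_projLeft]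
  e_α := by
    refine HopfAlg.Hom.ext ?_
    change T.semidirectInr ≫ projRight _ _ = 𝟙 _
    rw [← Category.id_comp T.semidirectInr, comp_semidirectInr, pair_projRight]
  e_lam := by
    change T.semidirectInr ≫ projLeft _ _ = _
    rw [← Category.id_comp T.semidirectInr, comp_semidirectInr, pair_projLeft]
  κ_α := by
    change T.semidirectInl ≫ projRight _ _ = _
    rw [← Category.id_comp T.semidirectInl, comp_semidirectInl, pair_projRight]
  decomp := by
    change Δ[T.X.X ⊗ T.B.X] ≫ (projLeft _ _ ≫ T.semidirectInl ⊗ₘ projRight _ _ ≫ T.semidirectInr) ≫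
      T.semidirectMul = 𝟙 (T.X.X ⊗ T.B.X)
    rw [comp_semidirectInl, comp_semidirectInr, ← Category.assoc, ← pair,
      T.pair_semidirectMul (.inl inferInstance) (Commutes.counit_one_left _ _), pair_one_act,
      HopfAlg.pair_mul_one, HopfAlg.pair_one_mul, pair_proj]
  lam_mul := by
    change (T.semidirectInl ⊗ₘ T.semidirectInr) ≫ T.semidirectMul ≫ projLeft _ _ = projLeft _ _
    refine hom_ext_pair fun D _ x b _ _ w => ?_
    rw [pair_tensorHom_assoc, comp_semidirectInl, comp_semidirectInr, ← Category.assoc,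
      T.pair_semidirectMul (.inl inferInstance) (Commutes.counit_one_left _ _), pair_one_act,
      HopfAlg.pair_mul_one, HopfAlg.pair_one_mul]
  comul_extAct := by rw [extAct_semidirect]; exact T.isAction.comul_act
  assoc_κ_e_id := T.semidirect_assoc_inl_inr_id
  assoc_κ_id_e := T.semidirect_assoc_inl_id_inr
  assoc_id_κ_e := T.semidirect_assoc_id_inl_inr
  assoc_e_id_κ := T.semidirect_assoc_inr_id_inl
  extAct_SL := by rw [extAct_semidirect]; exact T.isAction.act_SL.symm
  extAct_SR := by rw [extAct_semidirect]; exact T.isAction.act_SR.symm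
  isComonHom_lam := inferInstanceAs (IsComonHom (projLeft T.X.X T.B.X))
  one_lam := by
    change T.semidirectOne ≫ projLeft _ _ = T.X.one
    let _ := ComonObj.instTensorUnit C
    rw [← Category.id_comp T.semidirectOne, ← ComonObj.instTensorUnit_counit,
      counit_semidirectOne, pair_projLeft]
    simp

end Act

/-! ### The action of a split extension -/

section Actions

variable {C : Type u} [Category.{v} C] [MonoidalCategory C] [SymmetricCategory C]
variable {X A B : HopfAlg C} {κ : X ⟶ A} {α : A ⟶ B} {e : B ⟶ A} {lam : A.X ⟶ X.X}
variable {D : C} [ComonObj D]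

theorem pair_extAct (κ : X ⟶ A) (e : B ⟶ A) (lam : A.X ⟶ X.X) (b : D ⟶ B.X) (x : D ⟶ X.X) :
    pair b x ≫ extAct κ e lam = pair (b ≫ e.hom) (x ≫ κ.hom) ≫ A.mul ≫ lam := by
  rw [extAct, pair_tensorHom_assoc]

theorem HopfAlg.counit_one_hom {A A' : HopfAlg C} (f : A ⟶ A') :
    (ε[D] ≫ A.one) ≫ f.hom = ε[D] ≫ A'.one := by
  rw [Category.assoc, f.isHopfHom.map_one]

namespace IsSplitExt

variable (h : IsSplitExt κ α e lam)

include h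

theorem isComonHom_extAct : IsComonHom (extAct κ e lam) := by
  have := h.isComonHom_lam
  have := isComonHom_tensorHom e.hom κ.hom
  exact inferInstanceAs (IsComonHom ((e.hom ⊗ₘ κ.hom) ≫ A.mul ≫ lam))

/-- The decomposition `a = κλ(a₁) eα(a₂)` of a generalized element. -/
theorem eq_pair_mul (a : D ⟶ A.X) [IsComonHom a] :
    pair ((a ≫ lam) ≫ κ.hom) ((a ≫ α.hom) ≫ e.hom) ≫ A.mul = a := by
  have h' := a ≫= h.decomp
  rwa [← Category.assoc, comp_comul, pair_tensorHom_assoc, ← Category.assoc a lam,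
    ← Category.assoc a α.hom, Category.comp_id] at h'

theorem pair_mul_lam (x : D ⟶ X.X) {b : D ⟶ B.X} (hb : b ≫ ε[B.X] = ε[D]) :
    pair (x ≫ κ.hom) (b ≫ e.hom) ≫ A.mul ≫ lam = x := by
  have h' := pair x b ≫= h.lam_mul
  rwa [pair_tensorHom_assoc, pair_whiskerLeft_assoc, hb, pair_counit_rightUnitor] at h'

theorem hom_e_α : e.hom ≫ α.hom = 𝟙 B.X := congrArg HopfAlg.Hom.hom h.e_α

theorem pair_mul_assoc_κ_e_id (x : D ⟶ X.X) (b : D ⟶ B.X) (a : D ⟶ A.X) :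
    pair (pair (x ≫ κ.hom) (b ≫ e.hom) ≫ A.mul) a ≫ A.mul =
      pair (x ≫ κ.hom) (pair (b ≫ e.hom) a ≫ A.mul) ≫ A.mul := by
  simpa using pair (pair x b) a ≫= h.assoc_κ_e_id

theorem pair_mul_assoc_κ_id_e (x : D ⟶ X.X) (a : D ⟶ A.X) (b : D ⟶ B.X) :
    pair (pair (x ≫ κ.hom) a ≫ A.mul) (b ≫ e.hom) ≫ A.mul =
      pair (x ≫ κ.hom) (pair a (b ≫ e.hom) ≫ A.mul) ≫ A.mul := by
  simpa using pair (pair x a) b ≫= h.assoc_κ_id_e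

theorem pair_mul_assoc_id_κ_e (a : D ⟶ A.X) (x : D ⟶ X.X) (b : D ⟶ B.X) :
    pair (pair a (x ≫ κ.hom) ≫ A.mul) (b ≫ e.hom) ≫ A.mul =
      pair a (pair (x ≫ κ.hom) (b ≫ e.hom) ≫ A.mul) ≫ A.mul := by
  simpa using pair (pair a x) b ≫= h.assoc_id_κ_e

theorem pair_mul_assoc_e_id_κ (b : D ⟶ B.X) (a : D ⟶ A.X) (x : D ⟶ X.X) :
    pair (pair (b ≫ e.hom) a ≫ A.mul) (x ≫ κ.hom) ≫ A.mul =
      pair (b ≫ e.hom) (pair a (x ≫ κ.hom) ≫ A.mul) ≫ A.mul := by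
  simpa using pair (pair b a) x ≫= h.assoc_e_id_κ

/-- The exchange law `e(b) κ(x) = κ(b₁ ▷ x) e(b₂)` in a split extension. -/
theorem exchange {b : D ⟶ B.X} {x : D ⟶ X.X} [IsComonHom b] [IsComonHom x] (w : Commutes b x) :
    pair (b ≫ e.hom) (x ≫ κ.hom) ≫ A.mul =
      pair ((pair b x ≫ extAct κ e lam) ≫ κ.hom) (b ≫ e.hom) ≫ A.mul := by
  have := isComonHom_pair (w.comp e.hom κ.hom)
  have h' := h.eq_pair_mul (pair (b ≫ e.hom) (x ≫ κ.hom) ≫ A.mul)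
  rw [HopfAlg.pair_mul_hom, Category.assoc b, h.hom_e_α, Category.comp_id, Category.assoc x,
    h.κ_α, IsComonHom.hom_counit_assoc, HopfAlg.pair_mul_one] at h'
  rw [pair_extAct, ← Category.assoc _ A.mul lam, h']

theorem isAction : IsAction B X (extAct κ e lam) where
  one_act := by
    rw [← cancel_epi (λ_ X.X).inv, Iso.inv_hom_id, ← Category.id_comp (λ_ X.X).inv,
      ← pair_counit_left, pair_whiskerRight_assoc, pair_extAct, HopfAlg.counit_one_hom,
      ← Category.assoc, HopfAlg.pair_one_mul, Category.id_comp, h.κ_lam]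
  act_one := by
    rw [← cancel_epi (ρ_ B.X).inv, Iso.inv_hom_id_assoc, ← Category.id_comp (ρ_ B.X).inv,
      ← pair_counit_right, pair_whiskerLeft_assoc, pair_extAct, HopfAlg.counit_one_hom,
      ← Category.assoc, HopfAlg.pair_mul_one, Category.id_comp, h.e_lam]
  comul_act := h.comul_extAct
  isComonHom := h.isComonHom_extAct
  mul_act := hom_ext_pair_pair_left fun D _ b c x _ _ _ hbc hbx hcx => by
    have := h.isComonHom_extAct
    have := isComonHom_pair hcx
    have := isComonHom_pair hbc
    have w : Commutes b (pair c x ≫ extAct κ e lam) := (hbc.pair_right hbx).comp_right _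
    -- `(e(b) e(c)) κ(x) = e(b) (κ(c ▷ x) e(c)) = κ(b ▷ (c ▷ x)) (e(b) e(c))`
    rw [pair_whiskerRight_assoc, pair_extAct, HopfAlg.pair_mul_hom, ← Category.assoc,
      h.pair_mul_assoc_e_id_κ, h.exchange hcx, ← h.pair_mul_assoc_id_κ_e, h.exchange w,
      h.pair_mul_assoc_κ_id_e, ← HopfAlg.pair_mul_hom, Category.assoc,
      h.pair_mul_lam _ (IsComonHom.hom_counit _), pair_associator_assoc, pair_whiskerLeft_assoc]
  act_mul := hom_ext_pair fun D _ b z _ _ w => by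
    obtain ⟨x, y, hx, hy, -, rfl⟩ := exists_eq_pair z
    have hbx : Commutes b x := by simpa using w.comp_right (projLeft _ _)
    have hby : Commutes b y := by simpa using w.comp_right (projRight _ _)
    -- `e(b) (κ(x) κ(y)) = (κ(b ▷ x) e(b)) κ(y) = (κ(b ▷ x) κ(b ▷ y)) e(b)`
    rw [pair_whiskerLeft_assoc, pair_extAct, HopfAlg.pair_mul_hom, ← Category.assoc,
      ← h.pair_mul_assoc_e_id_κ, h.exchange hbx, h.pair_mul_assoc_κ_e_id, h.exchange hby,
      ← h.pair_mul_assoc_κ_id_e, ← HopfAlg.pair_mul_hom, Category.assoc,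
      h.pair_mul_lam _ (IsComonHom.hom_counit _), pair_whiskerRight_assoc, comp_comul,
      pair_pair_tensorμ_assoc hbx, pair_tensorHom_assoc]
  act_SL := h.extAct_SL.symm
  act_SR := h.extAct_SR.symm

end IsSplitExt

end Actions

/-! ### The equivalence -/

theorem IsHopfHom.of_inverse {C : Type u} [Category.{v} C] [MonoidalCategory C]
    {A A' : HopfData C} {f : A.X ⟶ A'.X} (h : IsHopfHom A A' f) {g : A'.X ⟶ A.X}
    (hfg : f ≫ g = 𝟙 A.X) (hgf : g ≫ f = 𝟙 A'.X) : IsHopfHom A' A g := by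
  have : IsIso f := ⟨g, hfg, hgf⟩
  obtain rfl : g = inv f := IsIso.eq_inv_of_hom_inv_id hfg
  constructor
  · rw [IsIso.comp_inv_eq, Category.assoc, h.map_mul]; simp
  · rw [IsIso.comp_inv_eq, h.map_one]
  · rw [IsIso.inv_comp_eq, ← Category.assoc, h.map_comul]; simp
  · rw [IsIso.inv_comp_eq, h.map_counit]
  · rw [IsIso.comp_inv_eq, Category.assoc, h.map_SL]; simp
  · rw [IsIso.comp_inv_eq, Category.assoc, h.map_SR]; simp

variable {C : Type u} [Category.{v} C] [MonoidalCategory C] [SymmetricCategory C]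

namespace SplitExt

variable (S : SplitExt C) {S' : SplitExt C}

/-- The action of `B` on `X` in a split extension. -/
abbrev toAct : Act C where
  B := S.B
  X := S.X
  act := extAct S.κ S.e S.lam
  isAction := S.isSplitExt.isAction

variable (C) in
/-- The functor that sends a split extension to its action. -/
def actFunctor : SplitExt C ⥤ Act C where
  obj S := S.toAct
  map {S S'} f :=
    { g := f.g
      v := f.v
      comm := by
        have hκ : S.κ.hom ≫ f.p.hom = f.v.hom ≫ S'.κ.hom := congrArg HopfAlg.Hom.hom f.comm_κ
        have he : S.e.hom ≫ f.p.hom = f.g.hom ≫ S'.e.hom := congrArg HopfAlg.Hom.hom f.comm_e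
        change extAct S.κ S.e S.lam ≫ f.v.hom = _ ≫ extAct S'.κ S'.e S'.lam
        rw [extAct, extAct, Category.assoc, Category.assoc, f.comm_lam,
          reassoc_of% f.p.isHopfHom.map_mul, tensorHom_comp_tensorHom_assoc, hκ, he,
          ← tensorHom_comp_tensorHom_assoc] }
  map_id _ := rfl
  map_comp _ _ := rfl

/-- The comparison `x ⊗ b ↦ κ(x) e(b)` from the semidirect product to the total object. -/
def comparison : S.X.X ⊗ S.B.X ⟶ S.A.X := (S.κ.hom ⊗ₘ S.e.hom) ≫ S.A.mul

/-- The inverse of the comparison, `a ↦ λ(a₁) ⊗ α(a₂)`. -/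
def comparisonInv : S.A.X ⟶ S.X.X ⊗ S.B.X := pair S.lam S.α.hom

variable {D : C} [ComonObj D]

theorem pair_comparison (x : D ⟶ S.X.X) (b : D ⟶ S.B.X) :
    pair x b ≫ S.comparison = pair (x ≫ S.κ.hom) (b ≫ S.e.hom) ≫ S.A.mul := by
  rw [comparison, pair_tensorHom_assoc]

theorem comparisonInv_comparison : S.comparisonInv ≫ S.comparison = 𝟙 S.A.X := by
  rw [comparisonInv, pair_comparison]
  simpa using S.isSplitExt.eq_pair_mul (𝟙 S.A.X)

instance : IsComonHom S.comparison := by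
  have := isComonHom_tensorHom S.κ.hom S.e.hom
  exact inferInstanceAs (IsComonHom ((S.κ.hom ⊗ₘ S.e.hom) ≫ S.A.mul))

theorem comparison_lam : S.comparison ≫ S.lam = projLeft S.X.X S.B.X :=
  (Category.assoc _ _ _).trans S.isSplitExt.lam_mul

theorem comparison_α : S.comparison ≫ S.α.hom = projRight S.X.X S.B.X :=
  hom_ext_pair fun D _ x b _ _ w => by
    rw [← Category.assoc, pair_comparison, HopfAlg.pair_mul_hom, Category.assoc, Category.assoc,
      S.isSplitExt.hom_e_α, S.isSplitExt.κ_α, IsComonHom.hom_counit_assoc, HopfAlg.pair_one_mul,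
      Category.comp_id, pair_projRight]

theorem comparison_comparisonInv : S.comparison ≫ S.comparisonInv = 𝟙 (S.X.X ⊗ S.B.X) := by
  rw [comparisonInv, comp_pair, comparison_lam, comparison_α, pair_proj]

/-- The exchange law in terms of `theta`. -/
theorem theta_comparison :
    S.toAct.theta ≫ S.comparison = (S.e.hom ⊗ₘ S.κ.hom) ≫ S.A.mul :=
  hom_ext_pair fun D _ (b : D ⟶ S.B.X) (x : D ⟶ S.X.X) _ _ w => by
    have hθ := S.toAct.pair_theta (.inl ‹IsComonHom b›) w
    rw [← Category.assoc, hθ, pair_tensorHom_assoc, S.isSplitExt.exchange w]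
    exact S.pair_comparison _ _

theorem semidirectMul_comparison :
    S.toAct.semidirectMul ≫ S.comparison = (S.comparison ⊗ₘ S.comparison) ≫ S.A.mul :=
  hom_ext_pair_pair fun D _ (x : D ⟶ S.X.X) (b : D ⟶ S.B.X) (y : D ⟶ S.X.X) (c : D ⟶ S.B.X)
      _ _ _ _ hxb hxy hxc hby hbc hyc => by
    have h := S.isSplitExt
    have hm := S.toAct.pair_semidirectMul (.inl ‹IsComonHom b›) hby x c
    rw [← Category.assoc, hm, pair_tensorHom_assoc, pair_comparison, pair_comparison S x b,
      pair_comparison S y c]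
    -- `(κ(x) κ(b ▷ y)) (e(b) e(c)) = (κ(x) (e(b) κ(y))) e(c) = (κ(x) e(b)) (κ(y) e(c))`
    rw [HopfAlg.pair_mul_hom S.κ, h.pair_mul_assoc_κ_id_e, HopfAlg.pair_mul_hom S.e,
      ← h.pair_mul_assoc_κ_id_e, ← h.exchange hby, ← h.pair_mul_assoc_κ_id_e,
      ← h.pair_mul_assoc_κ_e_id, h.pair_mul_assoc_id_κ_e]

theorem semidirectAntipode_comparison {sA : S.A.X ⟶ S.A.X} {sB : S.B.X ⟶ S.B.X}
    {sX : S.X.X ⟶ S.X.X} (hA : S.A.IsAntihom sA) (hκ : sX ≫ S.κ.hom = S.κ.hom ≫ sA)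
    (he : sB ≫ S.e.hom = S.e.hom ≫ sA) :
    S.toAct.semidirectAntipode sB sX ≫ S.comparison = S.comparison ≫ sA := by
  have h : S.toAct.semidirectAntipode sB sX ≫ S.comparison =
      (β_ S.X.X S.B.X).hom ≫ (sB ⊗ₘ sX) ≫ S.toAct.theta ≫ S.comparison := by
    simp only [Act.semidirectAntipode, Category.assoc]
  rw [h, theta_comparison, comparison, Category.assoc, hA.map_mul,
    BraidedCategory.braiding_naturality_assoc, tensorHom_comp_tensorHom_assoc,
    tensorHom_comp_tensorHom_assoc, hκ, he]

theorem isHopfHom_comparison :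
    IsHopfHom S.toAct.semidirect S.A.toHopfData S.comparison where
  map_mul := S.semidirectMul_comparison
  map_one := by
    change S.toAct.semidirectOne ≫ S.comparison = S.A.one
    let _ := ComonObj.instTensorUnit C
    have h1 : S.toAct.semidirectOne = pair (ε[𝟙_ C] ≫ S.X.one) (ε[𝟙_ C] ≫ S.B.one) :=
      (Category.id_comp _).symm.trans S.toAct.counit_semidirectOne
    rw [h1, pair_comparison, HopfAlg.counit_one_hom, HopfAlg.counit_one_hom, HopfAlg.pair_one_mul]
    exact Category.id_comp _
  map_comul := IsComonHom.hom_comul S.comparison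
  map_counit := IsComonHom.hom_counit S.comparison
  map_SL := S.semidirectAntipode_comparison S.A.isHopf.antihom_SL S.κ.isHopfHom.map_SL
    S.e.isHopfHom.map_SL
  map_SR := S.semidirectAntipode_comparison S.A.isHopf.antihom_SR S.κ.isHopfHom.map_SR
    S.e.isHopfHom.map_SR

end SplitExt

namespace Act

variable (T : Act C) {T' : Act C}

/-- The split extension given by the semidirect product. -/
abbrev toSplitExt : SplitExt C where
  X := T.X
  A := T.semidirectHopf
  B := T.B
  κ := T.inlHom
  α := T.sndHom
  e := T.inrHom
  lam := T.fst
  isSplitExt := T.isSplitExt_semidirect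

theorem theta_naturality (f : T ⟶ T') :
    T.theta ≫ (f.v.hom ⊗ₘ f.g.hom) = (f.g.hom ⊗ₘ f.v.hom) ≫ T'.theta :=
  hom_ext_pair fun D _ b x _ _ w => by
    rw [← Category.assoc, T.pair_theta (.inl inferInstance) w, pair_tensorHom,
      pair_tensorHom_assoc, T'.pair_theta (.inl inferInstance) (w.comp _ _), Category.assoc,
      f.comm, pair_tensorHom_assoc]

theorem semidirectMul_naturality (f : T ⟶ T') :
    T.semidirectMul ≫ (f.v.hom ⊗ₘ f.g.hom) =
      ((f.v.hom ⊗ₘ f.g.hom) ⊗ₘ (f.v.hom ⊗ₘ f.g.hom)) ≫ T'.semidirectMul :=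
  hom_ext_pair_pair fun D _ x b y c _ _ _ _ hxb hxy hxc hby hbc hyc => by
    rw [← Category.assoc, T.pair_semidirectMul (.inl inferInstance) hby, pair_tensorHom,
      pair_tensorHom_assoc, pair_tensorHom, pair_tensorHom,
      T'.pair_semidirectMul (.inl inferInstance) (hby.comp _ _), HopfAlg.pair_mul_hom,
      HopfAlg.pair_mul_hom, Category.assoc, f.comm, pair_tensorHom_assoc]

theorem semidirectAntipode_naturality (f : T ⟶ T') {sB : T.B.X ⟶ T.B.X} {sX : T.X.X ⟶ T.X.X}
    {sB' : T'.B.X ⟶ T'.B.X} {sX' : T'.X.X ⟶ T'.X.X} (hB : sB ≫ f.g.hom = f.g.hom ≫ sB')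
    (hX : sX ≫ f.v.hom = f.v.hom ≫ sX') :
    T.semidirectAntipode sB sX ≫ (f.v.hom ⊗ₘ f.g.hom) =
      (f.v.hom ⊗ₘ f.g.hom) ≫ T'.semidirectAntipode sB' sX' := by
  simp only [semidirectAntipode, Category.assoc, theta_naturality]
  rw [BraidedCategory.braiding_naturality_assoc, tensorHom_comp_tensorHom_assoc,
    tensorHom_comp_tensorHom_assoc, hB, hX]

theorem isHopfHom_tensorHom (f : T ⟶ T') :
    IsHopfHom T.semidirect T'.semidirect (f.v.hom ⊗ₘ f.g.hom) where
  map_mul := T.semidirectMul_naturality f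
  map_one := by
    change T.semidirectOne ≫ _ = T'.semidirectOne
    rw [semidirectOne, semidirectOne, Category.assoc, tensorHom_comp_tensorHom,
      f.v.isHopfHom.map_one, f.g.isHopfHom.map_one]
  map_comul := (isComonHom_tensorHom f.v.hom f.g.hom).hom_comul
  map_counit := (isComonHom_tensorHom f.v.hom f.g.hom).hom_counit
  map_SL := T.semidirectAntipode_naturality f f.g.isHopfHom.map_SL f.v.isHopfHom.map_SL
  map_SR := T.semidirectAntipode_naturality f f.g.isHopfHom.map_SR f.v.isHopfHom.map_SR

variable (C) in
/-- The functor that sends an action to the split extension given by its semidirect product. -/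
def splitExtFunctor : Act C ⥤ SplitExt C where
  obj T := T.toSplitExt
  map {T T'} f :=
    { g := f.g
      v := f.v
      p := ⟨f.v.hom ⊗ₘ f.g.hom, T.isHopfHom_tensorHom f⟩
      comm_κ := by
        refine HopfAlg.Hom.ext ?_
        change T.semidirectInl ≫ (f.v.hom ⊗ₘ f.g.hom) = f.v.hom ≫ T'.semidirectInl
        rw [← Category.id_comp T.semidirectInl, comp_semidirectInl, comp_semidirectInl,
          pair_tensorHom, HopfAlg.counit_one_hom, Category.id_comp]
      comm_α := by
        refine HopfAlg.Hom.ext ?_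
        change projRight _ _ ≫ f.g.hom = (f.v.hom ⊗ₘ f.g.hom) ≫ projRight _ _
        rw [tensorHom_eq_pair, pair_projRight]
      comm_e := by
        refine HopfAlg.Hom.ext ?_
        change T.semidirectInr ≫ (f.v.hom ⊗ₘ f.g.hom) = f.g.hom ≫ T'.semidirectInr
        rw [← Category.id_comp T.semidirectInr, comp_semidirectInr, comp_semidirectInr,
          pair_tensorHom, HopfAlg.counit_one_hom, Category.id_comp]
      comm_lam := by
        change projLeft _ _ ≫ f.v.hom = (f.v.hom ⊗ₘ f.g.hom) ≫ projLeft _ _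
        rw [tensorHom_eq_pair, pair_projLeft] }
  map_id T := SplitExt.Hom.ext rfl rfl (HopfAlg.Hom.ext (id_tensorHom_id _ _))
  map_comp f f' := SplitExt.Hom.ext rfl rfl
    (HopfAlg.Hom.ext (tensorHom_comp_tensorHom _ _ _ _).symm)

/-- The action of the semidirect product extension is the action one started with. -/
def toSplitExtToActIso : T.toSplitExt.toAct ≅ T where
  hom :=
    { g := 𝟙 T.B
      v := 𝟙 T.X
      comm := by
        change extAct T.inlHom T.inrHom T.fst ≫ 𝟙 T.X.X = (𝟙 T.B.X ⊗ₘ 𝟙 T.X.X) ≫ T.act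
        rw [extAct_semidirect, id_tensorHom_id, Category.id_comp, Category.comp_id] }
  inv :=
    { g := 𝟙 T.B
      v := 𝟙 T.X
      comm := by
        change T.act ≫ 𝟙 T.X.X = (𝟙 T.B.X ⊗ₘ 𝟙 T.X.X) ≫ extAct T.inlHom T.inrHom T.fst
        rw [extAct_semidirect, id_tensorHom_id, Category.id_comp, Category.comp_id] }
  hom_inv_id := Act.Hom.ext (Category.id_comp _) (Category.id_comp _)
  inv_hom_id := Act.Hom.ext (Category.id_comp _) (Category.id_comp _)

end Act

namespace SplitExt

variable (S : SplitExt C)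

/-- The comparison as an isomorphism of Hopf algebras. -/
def comparisonIso : S.toAct.semidirectHopf ≅ S.A where
  hom := ⟨S.comparison, S.isHopfHom_comparison⟩
  inv := ⟨S.comparisonInv, S.isHopfHom_comparison.of_inverse S.comparison_comparisonInv
    S.comparisonInv_comparison⟩
  hom_inv_id := HopfAlg.Hom.ext S.comparison_comparisonInv
  inv_hom_id := HopfAlg.Hom.ext S.comparisonInv_comparison

theorem inl_comparison : S.toAct.inlHom ≫ S.comparisonIso.hom = S.κ := by
  refine HopfAlg.Hom.ext ?_
  change S.toAct.semidirectInl ≫ S.comparison = S.κ.hom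
  have h : S.toAct.semidirectInl = pair (𝟙 S.X.X) (ε[S.X.X] ≫ S.B.one) :=
    (Category.id_comp _).symm.trans (S.toAct.comp_semidirectInl (𝟙 S.X.X))
  rw [h, pair_comparison, HopfAlg.counit_one_hom, HopfAlg.pair_mul_one, Category.id_comp]

theorem inr_comparison : S.toAct.inrHom ≫ S.comparisonIso.hom = S.e := by
  refine HopfAlg.Hom.ext ?_
  change S.toAct.semidirectInr ≫ S.comparison = S.e.hom
  have h : S.toAct.semidirectInr = pair (ε[S.B.X] ≫ S.X.one) (𝟙 S.B.X) :=
    (Category.id_comp _).symm.trans (S.toAct.comp_semidirectInr (𝟙 S.B.X))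
  rw [h, pair_comparison, HopfAlg.counit_one_hom, HopfAlg.pair_one_mul, Category.id_comp]

theorem comparison_snd : S.comparisonIso.hom ≫ S.α = S.toAct.sndHom :=
  HopfAlg.Hom.ext S.comparison_α

/-- A split extension is isomorphic to the one given by the semidirect product of its action. -/
def toActToSplitExtIso : S.toAct.toSplitExt ≅ S where
  hom :=
    { g := 𝟙 S.B
      v := 𝟙 S.X
      p := S.comparisonIso.hom
      comm_κ := S.inl_comparison.trans (Category.id_comp S.κ).symm
      comm_α := (Category.comp_id S.toAct.sndHom).trans S.comparison_snd.symm
      comm_e := S.inr_comparison.trans (Category.id_comp S.e).symm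
      comm_lam := (Category.comp_id (projLeft S.X.X S.B.X)).trans S.comparison_lam.symm }
  inv :=
    { g := 𝟙 S.B
      v := 𝟙 S.X
      p := S.comparisonIso.inv
      comm_κ := by
        refine Eq.trans ?_ (Category.id_comp S.toAct.inlHom).symm
        rw [Iso.comp_inv_eq, inl_comparison]
      comm_α := by
        refine (Category.comp_id S.α).trans ?_
        exact (S.comparisonIso.eq_inv_comp).2 S.comparison_snd
      comm_e := by
        refine Eq.trans ?_ (Category.id_comp S.toAct.inrHom).symm
        rw [Iso.comp_inv_eq, inr_comparison]
      comm_lam := by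
        change S.lam ≫ 𝟙 S.X.X = S.comparisonInv ≫ projLeft _ _
        rw [← S.comparison_lam, ← Category.assoc, S.comparisonInv_comparison, Category.id_comp,
          Category.comp_id] }
  hom_inv_id := SplitExt.Hom.ext (Category.id_comp _) (Category.id_comp _)
    S.comparisonIso.hom_inv_id
  inv_hom_id := SplitExt.Hom.ext (Category.id_comp _) (Category.id_comp _)
    S.comparisonIso.inv_hom_id

theorem comparison_naturality {S S' : SplitExt C} (f : S ⟶ S') :
    (f.v.hom ⊗ₘ f.g.hom) ≫ S'.comparison = S.comparison ≫ f.p.hom := by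
  have hκ : S.κ.hom ≫ f.p.hom = f.v.hom ≫ S'.κ.hom := congrArg HopfAlg.Hom.hom f.comm_κ
  have he : S.e.hom ≫ f.p.hom = f.g.hom ≫ S'.e.hom := congrArg HopfAlg.Hom.hom f.comm_e
  rw [comparison, comparison, Category.assoc, f.p.isHopfHom.map_mul,
    tensorHom_comp_tensorHom_assoc, tensorHom_comp_tensorHom_assoc, hκ, he]

variable (C) in
/-- Split extensions and actions of Hopf algebras are equivalent. -/
def equivAct : SplitExt C ≌ Act C :=
  CategoryTheory.Equivalence.mk (actFunctor C) (Act.splitExtFunctor C)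
    (NatIso.ofComponents (fun S => S.toActToSplitExtIso) fun {S S'} (f : S.Hom S') =>
      SplitExt.Hom.ext
      ((Category.comp_id f.g).trans (Category.id_comp f.g).symm)
      ((Category.comp_id f.v).trans (Category.id_comp f.v).symm)
      (HopfAlg.Hom.ext (comparison_naturality f))).symm
    (NatIso.ofComponents (fun T => T.toSplitExtToActIso) fun {T T'} (f : T.Hom T') => Act.Hom.ext
      ((Category.comp_id f.g).trans (Category.id_comp f.g).symm)
      ((Category.comp_id f.v).trans (Category.id_comp f.v).symm))

end SplitExt

end NonassocHopf

/-- The categories of split extensions and of actions of non-associative Hopf algebras are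
equivalent, through the functor that sends a split extension to the action `lam ∘ m ∘ (e ⊗ κ)` and
the functor that sends an action to the semidirect product extension. -/
theorem theorem4 (C : Type u) [Category.{v} C] [MonoidalCategory C] [SymmetricCategory C] :
    ∃ E : NonassocHopf.SplitExt C ≌ NonassocHopf.Act C,
      (∀ S : NonassocHopf.SplitExt C,
        ∃ h : NonassocHopf.IsAction S.B S.X (NonassocHopf.extAct S.κ S.e S.lam),
          E.functor.obj S =
            { B := S.B, X := S.X, act := NonassocHopf.extAct S.κ S.e S.lam, isAction := h }) ∧
      E.functor ⋙ NonassocHopf.Act.ends C = NonassocHopf.SplitExt.ends C ∧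
      (∀ T : NonassocHopf.Act C,
        ∃ (hA : T.semidirect.IsHopf)
          (hκ : NonassocHopf.IsHopfHom T.X.toHopfData T.semidirect T.inl)
          (hα : NonassocHopf.IsHopfHom T.semidirect T.B.toHopfData T.snd)
          (he : NonassocHopf.IsHopfHom T.B.toHopfData T.semidirect T.inr)
          (h : NonassocHopf.IsSplitExt (X := T.X) (A := ⟨T.semidirect, hA⟩) (B := T.B)
            ⟨T.inl, hκ⟩ ⟨T.snd, hα⟩ ⟨T.inr, he⟩ T.fst),
          E.inverse.obj T =
            { X := T.X, A := ⟨T.semidirect, hA⟩, B := T.B, κ := ⟨T.inl, hκ⟩, α := ⟨T.snd, hα⟩,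
              e := ⟨T.inr, he⟩, lam := T.fst, isSplitExt := h }) ∧
      E.inverse ⋙ NonassocHopf.SplitExt.ends C = NonassocHopf.Act.ends C ∧
      E.inverse ⋙ NonassocHopf.SplitExt.total C = NonassocHopf.Act.tensor C :=
  ⟨NonassocHopf.SplitExt.equivAct C, fun S => ⟨S.isSplitExt.isAction, rfl⟩, rfl,
    fun T => ⟨T.isHopf_semidirect, T.isHopfHom_inl, T.isHopfHom_snd, T.isHopfHom_inr,
      T.isSplitExt_semidirect, rfl⟩, rfl, rfl⟩
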